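/- For a field $K$ and square matrices $X,Y$ over $K$ write $X\perp Y=\begin{pmatrix}X&O\\O&Y\end{pmatrix}$, and for a matrix $X$ write $A[X]={}^tXAX$. A symmetric matrix over $\mathbb{Q}$ (resp. $\mathbb{Q}_q$) is called half-integral over $\mathbb{Z}$ (resp. $\mathbb{Z}_q$) if its diagonal entries lie in $\mathbb{Z}$ (resp. $\mathbb{Z}_q$) and its off-diagonal entries lie in $\tfrac12\mathbb{Z}$ (resp. $\tfrac12\mathbb{Z}_q$). Let $\Lambda_4^+$ be the set of positive definite half-integral matrices of degree $4$ over $\mathbb{Z}$. The level of $S\in\Lambda_4^+$ is the least positive integer $N$ such that $N(2S)^{-1}$ has integral entries and even diagonal entries. For a prime $q$, write $A\sim_{GL_4(\mathbb{Z}_q)}B$ if $B=A[X]$ for some $X\in GL_4(\mathbb{Z}_q)$. For $0\ne a\in\mathbb{Z}_q$ let $\chi_q(a)$ be $1$, $-1$ or $0$ according as $\mathbb{Q}_q(\sqrt a)$ is equal to $\mathbb{Q}_q$, an unramified quadratic extension of $\mathbb{Q}_q$, or a ramified quadratic extension of $\mathbb{Q}_q$. Let $p$ be an odd prime number, let $\epsilon\in\mathbb{Z}_p^\times$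 be such that $\chi_p(-\epsilon)=-1$, and put $U_0=1\perp\epsilon$, $H=\begin{pmatrix}0&1/2\\1/2&0\end{pmatrix}$ and $H_2=H\perp H$. For each prime number $q$ put $S_q=U_0\perp pU_0$ if $q=p$ and $S_q=H_2$ otherwise. Then there exists $S\in\Lambda_4^+$ with level $p$ and determinant $p^2/16$ such that $$S\sim_{GL_4(\mathbb{Z}_q)}S_q\quad\text{for every prime } q.\tag{E}$$ Conversely, every $S\in\Lambda_4^+$ with level $p$ and determinant $p^2/16$ satisfies condition (E). -/

import Mathlib

namespace QuadMat

open Matrix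

/-- `A[X] = ᵗX A X`. -/
def transf {K : Type*} [CommRing K] {m n : ℕ} (A : Matrix (Fin m) (Fin m) K)
    (X : Matrix (Fin m) (Fin n) K) : Matrix (Fin n) (Fin n) K :=
  Xᵀ * A * X

/-- For an integral domain `R` of characteristic different from `2` with field of fractions `K`:
the set of half-integral matrices of degree `n` over `R`, that is, the symmetric matrices over `K`
with diagonal entries in `R` and off-diagonal entries in `(1/2) R`. -/
def halfIntegral (R : Type*) (K : Type*) [CommRing R] [Field K] [Algebra R K]
    [IsFractionRing R K] (n : ℕ) : Set (Matrix (Fin n) (Fin n) K) :=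
  {A | A.IsSymm ∧ (∀ i, A i i ∈ (algebraMap R K).range) ∧
    ∀ i j, i ≠ j → 2 * A i j ∈ (algebraMap R K).range}

/-- The positive definite half-integral matrices of degree `n` over `ℤ`. -/
def posHalfIntegral (n : ℕ) : Set (Matrix (Fin n) (Fin n) ℚ) :=
  {S | S ∈ halfIntegral ℤ ℚ n ∧ (S.map (fun x : ℚ => (x : ℝ))).PosDef}

/-- `S` has level `N`: `N` is the least positive integer such that `N (2S)⁻¹` is even integral
(integral entries, even diagonal), that is, such that `(1/2) N (2S)⁻¹` is half-integral. It is only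
used for `S` nondegenerate. -/
def HasLevel {n : ℕ} (S : Matrix (Fin n) (Fin n) ℚ) (N : ℕ) : Prop :=
  IsLeast {M : ℕ | 0 < M ∧ (1 / 2 : ℚ) • ((M : ℚ) • ((2 : ℚ) • S)⁻¹) ∈ halfIntegral ℤ ℚ n} N

/-- The orthogonal sum `X ⊥ Y`, the block diagonal matrix with blocks `X` and `Y`. -/
def perp {K : Type*} [CommRing K] {m n : ℕ} (X : Matrix (Fin m) (Fin m) K)
    (Y : Matrix (Fin n) (Fin n) K) : Matrix (Fin (m + n)) (Fin (m + n)) K :=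
  Matrix.reindex finSumFinEquiv finSumFinEquiv (Matrix.fromBlocks X 0 0 Y)

/-- `GL_n(R)`-equivalence of matrices over `K ⊇ R`: `B = A[X]` for some `X ∈ GL_n(R)`. -/
def GLEquiv (R : Type*) {K : Type*} [CommRing R] [Field K] [Algebra R K] {n : ℕ}
    (A B : Matrix (Fin n) (Fin n) K) : Prop :=
  ∃ X : Matrix.GeneralLinearGroup (Fin n) R,
    B = transf A ((X : Matrix (Fin n) (Fin n) R).map (algebraMap R K))

/-- The field `ℚ_q(√a)`, inside an algebraic closure of `ℚ_q`. -/
noncomputable def sqrtField (q : ℕ) [Fact q.Prime] (a : ℤ_[q]) :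
    IntermediateField ℚ_[q] (AlgebraicClosure ℚ_[q]) :=
  IntermediateField.adjoin ℚ_[q]
    {x | x ^ 2 = algebraMap ℚ_[q] (AlgebraicClosure ℚ_[q]) (a : ℚ_[q])}

/-- `ℚ_q(√a) / ℚ_q` is unramified: the ring of integers of `ℚ_q(√a)`, which is the integral
closure of `ℤ_q`, is unramified over `ℤ_q`. -/
def SqrtUnramified (q : ℕ) [Fact q.Prime] (a : ℤ_[q]) : Prop :=
  Algebra.FormallyUnramified ℤ_[q] (integralClosure ℤ_[q] (sqrtField q a))

open Classical in
/-- For `a ≠ 0`: `χ_q(a)` is `1`, `-1` or `0` according as `ℚ_q(√a)` is `ℚ_q`, an unramified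
quadratic extension of `ℚ_q`, or a ramified quadratic extension of `ℚ_q`. -/
noncomputable def chi (q : ℕ) [Fact q.Prime] (a : ℤ_[q]) : ℤ :=
  if sqrtField q a = ⊥ then 1 else if SqrtUnramified q a then -1 else 0

/-- `U₀ = 1 ⊥ ε`. -/
def U0 {K : Type*} [Field K] (ε : K) : Matrix (Fin 2) (Fin 2) K :=
  perp !![1] !![ε]

/-- The half-integral hyperbolic plane `H`. -/
def H (K : Type*) [Field K] : Matrix (Fin 2) (Fin 2) K :=
  !![0, 1 / 2; 1 / 2, 0]

/-- `H₂ = H ⊥ H`. -/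
def H2 (K : Type*) [Field K] : Matrix (Fin 4) (Fin 4) K :=
  perp (H K) (H K)

/-- The local conditions on `S`: it is `GL₄(ℤ_p)`-equivalent to `U₀ ⊥ pU₀`, where `U₀ = 1 ⊥ ε`, and
`GL₄(ℤ_q)`-equivalent to `H₂` for every prime `q ≠ p`. -/
def LocalForms (p : ℕ) [Fact p.Prime] (ε : ℤ_[p]ˣ) (S : Matrix (Fin 4) (Fin 4) ℚ) : Prop :=
  GLEquiv ℤ_[p] (S.map (fun x : ℚ => (x : ℚ_[p])))
      (perp (U0 ((ε : ℤ_[p]) : ℚ_[p])) ((p : ℚ_[p]) • U0 ((ε : ℤ_[p]) : ℚ_[p]))) ∧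
    ∀ (q : ℕ) [Fact q.Prime], q ≠ p →
      GLEquiv ℤ_[q] (S.map (fun x : ℚ => (x : ℚ_[q]))) (H2 ℚ_[q])

end QuadMat

open Matrix

/-! Existence comes from an explicit family: a binary Hermitian form over the imaginary quadratic
order of discriminant `1 - 4c` has a quaternary trace form of determinant `((4c-1)s - a²)² / 16`. It
is positive definite of level `p` once `0 < c` and `(4c-1)s - a² = p`, which `exists_param` solves.
The local conditions then follow from the converse.

For the converse, `2S` is an even matrix of determinant `p²`. At `q ≠ p` it is unimodular with
square determinant. Chevalley–Warning and Hensel give an isotropic vector, a hyperbolic plane splits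
off, and the binary complement has square discriminant, hence is hyperbolic too
(`exists_hyperbolic`).

At `p`, the level and the determinant force `S ≅ ⟨1, δ⟩ ⊥ p⟨1, δ'⟩` with `δ`, `δ'` units and `δδ'` a
square (`padicInt_exists_diag`, `exists_GL_diagonal_one`). If `-δ` is not a square, then `δ`, `δ'`
and `ε` lie in one square class and the claim follows. If `-δ` were a square, `S` modulo `p` would
be a product of two linear forms; on the sublattice of index `p` where one of them vanishes, `S / p`
would be a positive definite even unimodular form of rank 4. Minkowski's theorem excludes this
(`false_of_linear_form`), so no product formula for Hasse invariants is needed. -/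

/-! ### Half-integral matrices as quadratic forms -/

/-- The matrix `C` is a bilinear form with `C(x, x) = S[x]`; it keeps the quadratic form available
integrally, which matters at the prime 2. -/
theorem mem_halfIntegral_iff {n : ℕ} {S : Matrix (Fin n) (Fin n) ℚ} :
    S ∈ QuadMat.halfIntegral ℤ ℚ n ↔
      ∃ C : Matrix (Fin n) (Fin n) ℤ, (2 : ℚ) • S = (C + Cᵀ).map (fun z : ℤ => (z : ℚ)) := by
  constructor
  · rintro ⟨hsymm, hd, ho⟩
    choose d hd using hd
    have ho' : ∀ i j, ∃ z : ℤ, (i ≠ j → (z : ℚ) = 2 * S i j) := fun i j => by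
      by_cases h : i = j
      · exact ⟨0, fun h' => absurd h h'⟩
      · obtain ⟨z, hz⟩ := ho i j h
        exact ⟨z, fun _ => by simpa using hz⟩
    choose o ho using ho'
    refine ⟨Matrix.of fun i j => if i = j then d i else if i < j then o i j else 0, ?_⟩
    ext i j
    rcases lt_trichotomy i j with h | rfl | h
    · simp [h.ne, h.ne', h, h.not_gt, ho i j h.ne]
    · have := hd i
      simp at this
      simp [this]; ring
    · have := hsymm.apply i j
      simp [h.ne, h.ne', h, h.not_gt, ho j i h.ne, this]
  · rintro ⟨C, hC⟩
    have h : ∀ i j, 2 * S i j = C i j + C j i := fun i j => by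
      have := congrFun (congrFun hC i) j
      simpa using this
    refine ⟨?_, fun i => ⟨C i i, ?_⟩, fun i j _ => ⟨C i j + C j i, ?_⟩⟩
    · ext i j
      have h1 := h i j
      have h2 := h j i
      simp only [transpose_apply]
      linarith
    · have := h i i
      simp; linarith
    · rw [h]; simp

/-! ### An explicit family of quaternary forms -/

/-- The Gram matrix of the quaternary form
`N(x) + s N(y) + a (x₂ y₁ - x₁ y₂)`, where `N(x) = x₁² + x₁ x₂ + c x₂²`. -/
def hermGram (a s c : ℤ) : Matrix (Fin 4) (Fin 4) ℤ :=
  !![2, 1, 0, -a; 1, 2 * c, a, 0; 0, a, 2 * s, s; -a, 0, s, 2 * s * c]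

/-- An upper triangular matrix `C` with `C + Cᵀ = hermGram a s c`. -/
def hermHalf (a s c : ℤ) : Matrix (Fin 4) (Fin 4) ℤ :=
  !![1, 1, 0, -a; 0, c, a, 0; 0, 0, s, s; 0, 0, 0, s * c]

/-- The half-integral matrix of the form described at `hermGram`. -/
def hermMat (a s c : ℤ) : Matrix (Fin 4) (Fin 4) ℚ :=
  (1 / 2 : ℚ) • (hermGram a s c).map (fun z : ℤ => (z : ℚ))

theorem hermHalf_add_transpose (a s c : ℤ) :
    hermHalf a s c + (hermHalf a s c)ᵀ = hermGram a s c := by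
  ext i j; fin_cases i <;> fin_cases j <;> simp [hermHalf, hermGram] <;> ring

theorem two_smul_hermMat (a s c : ℤ) :
    (2 : ℚ) • hermMat a s c = (hermGram a s c).map (fun z : ℤ => (z : ℚ)) := by
  rw [hermMat, smul_smul]; norm_num

theorem hermMat_mem (a s c : ℤ) : hermMat a s c ∈ QuadMat.halfIntegral ℤ ℚ 4 :=
  mem_halfIntegral_iff.2 ⟨hermHalf a s c, by
    rw [two_smul_hermMat, hermHalf_add_transpose]⟩

/-- An upper triangular matrix `D` such that `D + Dᵀ` is `(4c-1)s - a²` times the inverse of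
`hermGram a s c`. -/
def hermDual (a s c : ℤ) : Matrix (Fin 4) (Fin 4) ℤ :=
  !![s * c, -s, 0, a; 0, s, -a, 0; 0, 0, c, -1; 0, 0, 0, 1]

theorem hermGram_mul_dual (a s c : ℤ) :
    hermGram a s c * (hermDual a s c + (hermDual a s c)ᵀ) = ((4 * c - 1) * s - a ^ 2) • 1 := by
  ext i j; fin_cases i <;> fin_cases j <;>
    simp [hermDual, hermGram, Matrix.mul_apply, Fin.sum_univ_four] <;> ring

theorem hermGram_det (a s c : ℤ) :
    (hermGram a s c).det = ((4 * c - 1) * s - a ^ 2) ^ 2 := by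
  simp [hermGram, Matrix.det_succ_row_zero, Fin.sum_univ_succ, Fin.succAbove]
  ring

theorem hermMat_det (a s c : ℤ) :
    (hermMat a s c).det = (((4 * c - 1) * s - a ^ 2 : ℤ) : ℚ) ^ 2 / 16 := by
  have h : ((hermGram a s c).map (fun z : ℤ => (z : ℚ))).det = ((hermGram a s c).det : ℚ) :=
    (RingHom.map_det (Int.castRingHom ℚ) _).symm
  rw [hermMat, Matrix.det_smul, h, hermGram_det]
  simp; ring

theorem hermMat_posDef {a s c : ℤ} (hc : 0 < c) (h : 0 < (4 * c - 1) * s - a ^ 2) :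
    ((hermMat a s c).map (fun x : ℚ => (x : ℝ))).PosDef := by
  refine Matrix.PosDef.of_dotProduct_mulVec_pos ?_ fun x hx => ?_
  · ext i j
    fin_cases i <;> fin_cases j <;> simp [hermMat, hermGram]
  · have hr : (0 : ℝ) < 4 * c - 1 := by
      have : (1 : ℝ) ≤ c := by exact_mod_cast hc
      linarith
    have hr' : (4 * c - 1 : ℝ) ≠ 0 := hr.ne'
    have hd : (0 : ℝ) < (4 * c - 1) * s - a ^ 2 := by exact_mod_cast h
    -- Squares are completed in turn, so vanishing of the sum forces `x 3`, `x 2`, `x 1`, `x 0` to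
    -- vanish in that order.
    have key : star x ⬝ᵥ ((hermMat a s c).map (fun x : ℚ => (x : ℝ)) *ᵥ x) =
        (x 0 + x 1 / 2 - a * x 3 / 2) ^ 2
        + (4 * c - 1) / 4 * (x 1 + 2 * a / (4 * c - 1) * (x 2 + x 3 / 2)) ^ 2
        + ((4 * c - 1) * s - a ^ 2) / (4 * c - 1) * (x 2 + x 3 / 2) ^ 2
        + ((4 * c - 1) * s - a ^ 2) / 4 * x 3 ^ 2 := by
      simp [hermMat, hermGram, dotProduct, Matrix.mulVec, Fin.sum_univ_four]
      obtain ⟨r, hcr⟩ : ∃ r : ℝ, (c : ℝ) = (r + 1) / 4 := ⟨4 * c - 1, by ring⟩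
      have e : (4 * c - 1 : ℝ) = r := by rw [hcr]; ring
      rw [e] at hr'
      simp only [e]
      rw [hcr]
      field_simp
      ring
    rw [key]
    by_contra hle
    have t1 : 0 ≤ (x 0 + x 1 / 2 - a * x 3 / 2) ^ 2 := by positivity
    have t2 : 0 ≤ (4 * c - 1) / 4 * (x 1 + 2 * a / (4 * c - 1) * (x 2 + x 3 / 2)) ^ 2 := by
      positivity
    have t3 : 0 ≤ ((4 * c - 1) * s - a ^ 2) / (4 * c - 1) * (x 2 + x 3 / 2) ^ 2 := by
      positivity
    have t4 : 0 ≤ ((4 * c - 1) * s - a ^ 2) / 4 * x 3 ^ 2 := by positivity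
    have e4 : ((4 * c - 1) * s - a ^ 2) / 4 * x 3 ^ 2 = 0 := by linarith
    have x3 : x 3 = 0 := by
      rcases mul_eq_zero.1 e4 with h' | h'
      · exact absurd h' (by positivity)
      · exact pow_eq_zero_iff two_ne_zero |>.1 h'
    have e3 : ((4 * c - 1) * s - a ^ 2) / (4 * c - 1) * (x 2 + x 3 / 2) ^ 2 = 0 := by linarith
    have x2 : x 2 = 0 := by
      rcases mul_eq_zero.1 e3 with h' | h'
      · exact absurd h' (by positivity)
      · have := pow_eq_zero_iff two_ne_zero |>.1 h'
        linarith
    have e2 : (4 * c - 1) / 4 * (x 1 + 2 * a / (4 * c - 1) * (x 2 + x 3 / 2)) ^ 2 = 0 := by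
      linarith
    have x1 : x 1 = 0 := by
      rcases mul_eq_zero.1 e2 with h' | h'
      · exact absurd h' (by positivity)
      · simpa [x2, x3] using h'
    have e1 : (x 0 + x 1 / 2 - a * x 3 / 2) ^ 2 = 0 := by linarith
    have x0 : x 0 = 0 := by simpa [x1, x3] using e1
    exact hx (by ext i; fin_cases i <;> simp [x0, x1, x2, x3])

/-- An integral matrix `G` with `G * T = p` for an even matrix `T`, where `G` has determinant `p²`
and degree `4`, has level `p`. -/
theorem hasLevel_of_mul_eq {p : ℕ} [hp : Fact p.Prime] {S : Matrix (Fin 4) (Fin 4) ℚ}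
    {D : Matrix (Fin 4) (Fin 4) ℤ}
    (hdet : S.det = (p : ℚ) ^ 2 / 16)
    (hD : ((2 : ℚ) • S) * (D + Dᵀ).map (fun z : ℤ => (z : ℚ)) = (p : ℚ) • 1) :
    QuadMat.HasLevel S p := by
  have hp0 : (p : ℚ) ≠ 0 := by exact_mod_cast hp.out.ne_zero
  have hdet2 : ((2 : ℚ) • S).det = (p : ℚ) ^ 2 := by
    rw [Matrix.det_smul, hdet]; simp; ring
  have hinv : (p : ℚ) • ((2 : ℚ) • S)⁻¹ = (D + Dᵀ).map (fun z : ℤ => (z : ℚ)) := by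
    have : IsUnit ((2 : ℚ) • S).det := by
      rw [hdet2]; exact isUnit_iff_ne_zero.2 (by positivity)
    calc (p : ℚ) • ((2 : ℚ) • S)⁻¹ = ((2 : ℚ) • S)⁻¹ * ((p : ℚ) • 1) := by simp
      _ = _ := by rw [← hD, ← Matrix.mul_assoc, Matrix.nonsing_inv_mul _ this, Matrix.one_mul]
  refine ⟨⟨hp.out.pos, mem_halfIntegral_iff.2 ⟨D, ?_⟩⟩, ?_⟩
  · rw [hinv, smul_smul]; norm_num
  · rintro M ⟨hM0, hM⟩
    obtain ⟨E, hE⟩ := mem_halfIntegral_iff.1 hM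
    rw [smul_smul, show (2 : ℚ) * (1 / 2) = 1 by norm_num, one_smul] at hE
    have h := congrArg Matrix.det hE
    have h2 : ((E + Eᵀ).map (fun z : ℤ => (z : ℚ))).det = ((E + Eᵀ).det : ℚ) :=
      (RingHom.map_det (Int.castRingHom ℚ) _).symm
    rw [Matrix.det_smul, Matrix.det_nonsing_inv, hdet2, h2, Ring.inverse_eq_inv',
      Fintype.card_fin] at h
    -- The determinant of the integral matrix `M (2S)⁻¹` is `M⁴ / p²`, so `p` divides every
    -- admissible `M`.
    have h3 : ((M : ℤ) ^ 4) = (E + Eᵀ).det * (p : ℤ) ^ 2 := by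
      have : (M : ℚ) ^ 4 = (E + Eᵀ).det * (p : ℚ) ^ 2 := by
        rw [← h]; field_simp
      exact_mod_cast this
    have h4 : (p : ℤ) ∣ (M : ℤ) ^ 4 := by
      rw [h3]; exact Dvd.dvd.mul_left (dvd_pow_self _ two_ne_zero) _
    have h5 : p ∣ M := hp.out.dvd_of_dvd_pow (by exact_mod_cast h4)
    exact Nat.le_of_dvd hM0 h5

theorem hermMat_hasLevel {p : ℕ} [hp : Fact p.Prime] {a s c : ℤ}
    (h : (4 * c - 1) * s - a ^ 2 = p) : QuadMat.HasLevel (hermMat a s c) p := by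
  refine hasLevel_of_mul_eq (D := hermDual a s c) ?_ ?_
  · rw [hermMat_det, h]; simp
  · have := congrArg (fun M : Matrix (Fin 4) (Fin 4) ℤ => M.map (Int.castRingHom ℚ))
      (hermGram_mul_dual a s c)
    simp only [Matrix.map_mul] at this
    rw [two_smul_hermMat]
    refine this.trans ?_
    rw [h]
    ext i j
    by_cases hij : i = j
    · subst hij; simp [Matrix.natCast_apply]
    · simp [Matrix.natCast_apply, hij]

/-! ### Choice of the parameters -/

theorem isSquare_mul_of_not_isSquare {F : Type*} [Field F] [Finite F] {a b : F}
    (ha : ¬ IsSquare a) (hb : ¬ IsSquare b) : IsSquare (a * b) := by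
  classical
  have := Fintype.ofFinite F
  have ha0 : a ≠ 0 := by rintro rfl; exact ha IsSquare.zero
  have hb0 : b ≠ 0 := by rintro rfl; exact hb IsSquare.zero
  rw [← quadraticChar_one_iff_isSquare (mul_ne_zero ha0 hb0), map_mul,
    quadraticChar_neg_one_iff_not_isSquare.2 ha, quadraticChar_neg_one_iff_not_isSquare.2 hb]
  norm_num

/-- For `p ≡ 3` mod 4 take `4c - 1 = p`. For `p ≡ 1` mod 4, Dirichlet's theorem gives a prime `r ≡
3` mod 4 that is a nonresidue modulo `p`. By reciprocity `p` is a nonresidue modulo `r`, and so is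
`-1`; hence `-p` is a square modulo `r`, and `4c - 1 = r` works. -/
theorem exists_param {p : ℕ} [hp : Fact p.Prime] (h2 : p ≠ 2) :
    ∃ a s c : ℤ, 0 < c ∧ (4 * c - 1) * s - a ^ 2 = p := by
  have hodd : p % 2 = 1 := hp.out.eq_two_or_odd.resolve_left h2
  rcases (by omega : p % 4 = 1 ∨ p % 4 = 3) with h4 | h4
  · obtain ⟨n, hn⟩ : ∃ n : ZMod p, ¬ IsSquare n :=
      FiniteField.exists_nonsquare (by rwa [ringChar.eq (ZMod p) p])
    have hn0 : n ≠ 0 := by rintro rfl; exact hn (IsSquare.zero)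
    have hcop : Nat.Coprime 4 p := by
      rw [Nat.coprime_comm, hp.out.coprime_iff_not_dvd]
      intro h
      have := (Nat.prime_dvd_prime_iff_eq hp.out Nat.prime_two).1
        (hp.out.dvd_of_dvd_pow (show p ∣ 2 ^ 2 from h))
      exact h2 this
    have : NeZero (4 * p) := ⟨by have := hp.out.pos; omega⟩
    obtain ⟨k, hk4, hkp⟩ := Nat.chineseRemainder hcop 3 n.val
    have hkn : (k : ZMod p) = n := by
      rw [(ZMod.natCast_eq_natCast_iff k n.val p).2 hkp, ZMod.natCast_zmod_val]
    have hku : IsUnit (k : ZMod (4 * p)) := by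
      rw [ZMod.isUnit_iff_coprime]
      refine Nat.Coprime.mul_right ?_ ?_
      · have : k % 4 = 3 := hk4
        rw [Nat.coprime_iff_gcd_eq_one, Nat.gcd_comm, Nat.gcd_rec, this]; rfl
      · rw [Nat.coprime_comm, hp.out.coprime_iff_not_dvd, ← ZMod.natCast_eq_zero_iff, hkn]
        exact hn0
    obtain ⟨r, -, hr, hrk⟩ := Nat.forall_exists_prime_gt_and_eq_mod hku 0
    have hrm : r ≡ k [MOD 4 * p] := (ZMod.natCast_eq_natCast_iff _ _ _).1 hrk
    have hr4 : r % 4 = 3 := (hrm.of_mul_right p).trans hk4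
    have hrn : (r : ZMod p) = n := by
      rw [(ZMod.natCast_eq_natCast_iff r k p).2 (hrm.of_mul_left 4), hkn]
    have : Fact r.Prime := ⟨hr⟩
    have hrp : ¬ IsSquare (p : ZMod r) := by
      rwa [← ZMod.exists_sq_eq_prime_iff_of_mod_four_eq_one h4 (q := r) (by rintro rfl; omega), hrn]
    have hneg : ¬ IsSquare (-1 : ZMod r) := by
      rw [ZMod.exists_sq_eq_neg_one_iff]; omega
    have hsq : IsSquare (-(p : ZMod r)) := by
      have := isSquare_mul_of_not_isSquare hneg hrp
      simpa using this
    obtain ⟨y, hy⟩ := hsq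
    have hdvd : (r : ℤ) ∣ (y.val : ℤ) ^ 2 + p := by
      rw [← ZMod.intCast_zmod_eq_zero_iff_dvd]
      push_cast
      rw [ZMod.natCast_zmod_val]
      linear_combination -hy
    obtain ⟨s, hs⟩ := hdvd
    refine ⟨y.val, s, (r + 1) / 4, by omega, ?_⟩
    rw [show 4 * (((r : ℤ) + 1) / 4) - 1 = r by omega]
    linarith
  · exact ⟨0, 1, (p + 1) / 4, by omega, by omega⟩

theorem exists_posHalfIntegral {p : ℕ} [hp : Fact p.Prime] (h2 : p ≠ 2) :
    ∃ S : Matrix (Fin 4) (Fin 4) ℚ, S ∈ QuadMat.posHalfIntegral 4 ∧ QuadMat.HasLevel S p ∧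
      S.det = (p : ℚ) ^ 2 / 16 := by
  obtain ⟨a, s, c, hc, h⟩ := exists_param (p := p) h2
  refine ⟨hermMat a s c, ⟨hermMat_mem a s c, hermMat_posDef hc ?_⟩, hermMat_hasLevel h, ?_⟩
  · rw [h]; exact_mod_cast hp.out.pos
  · rw [hermMat_det, h]; simp

/-! ### Geometry of numbers -/

/-- Minkowski's convex body theorem for the ellipsoid `A[x] < 1`: its volume is `(π²/2) / √(det A) =
2π²`, which exceeds `2⁴`. -/
theorem exists_int_vec_lt_one {A : Matrix (Fin 4) (Fin 4) ℝ} (hA : A.PosDef)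
    (hdet : A.det = 1 / 16) :
    ∃ y : Fin 4 → ℤ, y ≠ 0 ∧ (fun i => (y i : ℝ)) ⬝ᵥ (A *ᵥ fun i => (y i : ℝ)) < 1 := by
  classical
  obtain ⟨B, hB⟩ : ∃ B : Matrix (Fin 4) (Fin 4) ℝ, A = Bᵀ * B := by
    open scoped MatrixOrder in
    obtain ⟨B, hB⟩ := CStarAlgebra.nonneg_iff_eq_star_mul_self.mp hA.posSemidef.nonneg
    exact ⟨B, by rw [hB, star_eq_conjTranspose, conjTranspose_eq_transpose_of_trivial]⟩
  have hdB : B.det ^ 2 = 1 / 16 := by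
    rw [← hdet, hB, det_mul, det_transpose, sq]
  have habs : |B.det| = 1 / 4 := by
    have : |B.det| ^ 2 = (1 / 4) ^ 2 := by rw [sq_abs, hdB]; norm_num
    exact (pow_left_inj₀ (abs_nonneg _) (by norm_num) two_ne_zero).1 this
  have hval : ∀ x : Fin 4 → ℝ, x ⬝ᵥ (A *ᵥ x) = ∑ i, (B *ᵥ x) i ^ 2 := by
    intro x
    rw [hB, ← mulVec_mulVec, dotProduct_mulVec, vecMul_transpose]
    simp [dotProduct, sq]
  set s : Set (Fin 4 → ℝ) := {x | ∑ i, |x i| ^ (2 : ℝ) < 1} with hs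
  have hs' : s = {x | ∑ i, x i ^ 2 < 1} := by
    ext x; simp [hs]
  have hvol : MeasureTheory.volume s = ENNReal.ofReal (Real.pi ^ 2 / 2) := by
    rw [hs, MeasureTheory.volume_sum_rpow_lt_one (Fin 4) (by norm_num)]
    congr 1
    rw [Real.Gamma_add_one (by norm_num), Real.Gamma_one_half_eq]
    have : (Real.Gamma (((Fintype.card (Fin 4) : ℕ) : ℝ) / 2 + 1)) = 2 := by
      have := Real.Gamma_nat_eq_factorial 2
      norm_num at this ⊢
    rw [this]
    have h4 : (Real.sqrt Real.pi) ^ 4 = Real.pi ^ 2 := by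
      rw [show 4 = 2 * 2 from rfl, pow_mul, Real.sq_sqrt Real.pi_pos.le]
    simp only [Fintype.card_fin]
    rw [← h4]; ring
  have hconv : Convex ℝ s := by
    rw [hs']
    have : ConvexOn ℝ Set.univ (fun x : Fin 4 → ℝ => ∑ i, x i ^ 2) := by
      have h : ∀ i : Fin 4, ConvexOn ℝ Set.univ (fun x : Fin 4 → ℝ => x i ^ 2) := fun i => by
        exact (even_two.convexOn_pow (𝕜 := ℝ)).comp_linearMap
          (LinearMap.proj i : (Fin 4 → ℝ) →ₗ[ℝ] ℝ)
      simp only [Fin.sum_univ_four]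
      exact (((h 0).add (h 1)).add (h 2)).add (h 3)
    simpa using this.convex_lt 1
  set b := Pi.basisFun ℝ (Fin 4)
  have hfd := ZSpan.isAddFundamentalDomain b (MeasureTheory.volume)
  have hvF : MeasureTheory.volume (ZSpan.fundamentalDomain b) = 1 := by
    rw [ZSpan.volume_fundamentalDomain]
    have : Matrix.of (⇑b) = 1 := by
      ext i j; simp [b, Matrix.one_apply, Pi.single_apply, eq_comm]
    simp [this]
  have hpre : MeasureTheory.volume ((Matrix.toLin' B) ⁻¹' s) = ENNReal.ofReal (2 * Real.pi ^ 2) := by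
    have h0 : B.det ≠ 0 := by
      intro h; rw [h] at habs; norm_num at habs
    rw [MeasureTheory.Measure.addHaar_preimage_linearMap _ (by rwa [LinearMap.det_toLin']),
      hvol, LinearMap.det_toLin', abs_inv, habs, ← ENNReal.ofReal_mul (by norm_num)]
    congr 1; ring
  have : Countable (Submodule.span ℤ (Set.range b)).toAddSubgroup :=
    inferInstanceAs (Countable (Submodule.span ℤ (Set.range b)))
  obtain ⟨x, hx0, hx⟩ :=
    MeasureTheory.exists_ne_zero_mem_lattice_of_measure_mul_two_pow_lt_measure
    (L := (Submodule.span ℤ (Set.range b)).toAddSubgroup) (s := (Matrix.toLin' B) ⁻¹' s)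
    (μ := MeasureTheory.volume) hfd (fun x hx => by simpa [hs', Matrix.mulVec_neg] using hx)
    (hconv.linear_preimage _) (by
      rw [hvF, hpre]
      have : (1 : ENNReal) * 2 ^ Module.finrank ℝ (Fin 4 → ℝ) = ENNReal.ofReal 16 := by
        simp; norm_num
      rw [this, ENNReal.ofReal_lt_ofReal_iff (by positivity)]
      nlinarith [Real.pi_gt_three])
  have hxm := (b.mem_span_iff_repr_mem ℤ x.1).1 x.2
  choose y hy using hxm
  have hy' : (fun i => (y i : ℝ)) = x.1 := by
    ext i; simpa [b] using hy i
  refine ⟨y, ?_, ?_⟩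
  · rintro rfl
    exact hx0 (Subtype.ext (by rw [← hy']; ext; simp))
  · rw [hy', hval]
    simpa [hs'] using hx

/-- There is no positive definite even unimodular lattice of rank `4`. -/
theorem det_ne_of_posDef_half {C : Matrix (Fin 4) (Fin 4) ℤ} {S : Matrix (Fin 4) (Fin 4) ℝ}
    (hS : S.PosDef) (hC : (2 : ℝ) • S = (C + Cᵀ).map (fun z : ℤ => (z : ℝ))) :
    S.det ≠ 1 / 16 := by
  intro hdet
  obtain ⟨y, hy0, hy⟩ := exists_int_vec_lt_one hS hdet
  have hpos := hS.dotProduct_mulVec_pos (x := fun i => (y i : ℝ)) (by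
    intro h
    exact hy0 (funext fun i => by simpa using congrFun h i))
  rw [star_trivial] at hpos
  have h : ∀ i j, S i j = (C i j + C j i) / 2 := fun i j => by
    have := congrFun (congrFun hC i) j
    simp at this
    linarith
  -- The value `S[y]` is an integer, yet it lies strictly between 0 and 1.
  have hval : (fun i => (y i : ℝ)) ⬝ᵥ (S *ᵥ fun i => (y i : ℝ)) = ((y ⬝ᵥ (C *ᵥ y) : ℤ) : ℝ) := by
    simp only [dotProduct, Matrix.mulVec, Fin.sum_univ_four, h]
    push_cast
    ring
  rw [hval] at hy hpos
  have h1 : 0 < y ⬝ᵥ (C *ᵥ y) := by exact_mod_cast hpos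
  have h2 : y ⬝ᵥ (C *ᵥ y) < 1 := by exact_mod_cast hy
  omega

/-- A positive definite half-integral form of determinant `p² / 16` cannot be divisible by `p` on
the zero set modulo `p` of a nonzero linear form. -/
theorem false_of_linear_form {p : ℕ} [hp : Fact p.Prime] {C : Matrix (Fin 4) (Fin 4) ℤ}
    {S : Matrix (Fin 4) (Fin 4) ℝ} (hS : S.PosDef)
    (hC : (2 : ℝ) • S = (C + Cᵀ).map (fun z : ℤ => (z : ℝ))) (hdet : S.det = (p : ℝ) ^ 2 / 16)
    {a : Fin 4 → ℤ} {j : Fin 4} (hj : ¬ (p : ℤ) ∣ a j)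
    (ha : ∀ x : Fin 4 → ℤ, (p : ℤ) ∣ a ⬝ᵥ x → (p : ℤ) ∣ x ⬝ᵥ (C *ᵥ x)) : False := by
  have hp0 : (p : ℝ) ≠ 0 := by exact_mod_cast hp.out.ne_zero
  obtain ⟨u, v, huv⟩ : IsCoprime (p : ℤ) (a j) :=
    (Nat.prime_iff_prime_int.1 hp.out).coprime_iff_not_dvd.2 hj
  -- The columns of `T` span the sublattice `a ⬝ᵥ x ≡ 0` mod `p`: since `v * a j ≡ 1`, coordinate
  -- `j` is determined modulo `p` by the others.
  set T : Matrix (Fin 4) (Fin 4) ℤ :=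
    (1 : Matrix (Fin 4) (Fin 4) ℤ).updateRow j (fun i => if i = j then (p : ℤ) else - v * a i)
    with hT
  have hTdet : T.det = p := by
    rw [hT]
    fin_cases j <;>
      simp [Matrix.det_succ_row_zero, Fin.sum_univ_succ, Fin.succAbove, Matrix.updateRow_apply,
        Matrix.one_apply]
  have hTx : ∀ x, (p : ℤ) ∣ a ⬝ᵥ (T *ᵥ x) := by
    intro x
    have hrow : ∀ i, (T *ᵥ x) i = if i = j then
        p * x j - v * (a ⬝ᵥ x - a j * x j) else x i := by
      intro i
      by_cases hij : i = j
      · subst hij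
        rw [if_pos rfl, hT]
        fin_cases i <;> simp [Matrix.mulVec, dotProduct, Fin.sum_univ_four] <;> ring
      · rw [if_neg hij, hT, Matrix.mulVec, Matrix.updateRow_ne hij]
        simp [dotProduct, Matrix.one_apply]
    have : a ⬝ᵥ (T *ᵥ x) = a ⬝ᵥ x - a j * x j + a j * (p * x j - v * (a ⬝ᵥ x - a j * x j)) := by
      have h1 := Finset.add_sum_erase Finset.univ (fun i => a i * (T *ᵥ x) i) (Finset.mem_univ j)
      have h2 := Finset.add_sum_erase Finset.univ (fun i => a i * x i) (Finset.mem_univ j)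
      have h3 : ∑ i ∈ Finset.univ.erase j, a i * (T *ᵥ x) i
          = ∑ i ∈ Finset.univ.erase j, a i * x i :=
        Finset.sum_congr rfl fun i hi => by rw [hrow, if_neg (Finset.ne_of_mem_erase hi)]
      simp only [hrow j, if_true] at h1
      change ∑ i, a i * (T *ᵥ x) i = _
      rw [← h1, h3]
      have h4 : a ⬝ᵥ x = ∑ i, a i * x i := rfl
      rw [h4, ← h2]; ring
    rw [this]
    refine ⟨u * (a ⬝ᵥ x - a j * x j) + a j * x j, ?_⟩
    linear_combination (a ⬝ᵥ x - a j * x j) * (-huv)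
  set F : Matrix (Fin 4) (Fin 4) ℤ := Tᵀ * C * T with hF
  have hFx : ∀ x, (p : ℤ) ∣ x ⬝ᵥ (F *ᵥ x) := by
    intro x
    have : x ⬝ᵥ (F *ᵥ x) = (T *ᵥ x) ⬝ᵥ (C *ᵥ (T *ᵥ x)) := by
      rw [hF, ← Matrix.mulVec_mulVec, ← Matrix.mulVec_mulVec, Matrix.dotProduct_mulVec,
        Matrix.vecMul_transpose]
    rw [this]
    exact ha _ (hTx x)
  have hFd : ∀ i, (p : ℤ) ∣ F i i := fun i => by
    simpa using hFx (Pi.single i 1)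
  have hFo : ∀ i j, (p : ℤ) ∣ F i j + F j i := fun i k => by
    have h := hFx (Pi.single i 1 + Pi.single k 1)
    have e : (Pi.single i 1 + Pi.single k 1 : Fin 4 → ℤ) ⬝ᵥ
        (F *ᵥ (Pi.single i 1 + Pi.single k 1)) = F i i + F k k + (F i k + F k i) := by
      simp [Matrix.mulVec_add, add_dotProduct]; ring
    rw [e] at h
    exact (Int.dvd_iff_dvd_of_dvd_add h).1 ((hFd i).add (hFd k)) |> fun h => h
  choose d hd using hFd
  choose o ho using hFo
  -- An upper triangular integral matrix with `p (D + Dᵀ) = F + Fᵀ`; it shows that the form rescaled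
  -- by `1/p` is still half-integral.
  set D : Matrix (Fin 4) (Fin 4) ℤ :=
    Matrix.of fun i j => if i = j then d i else if i < j then o i j else 0
  set Tr : Matrix (Fin 4) (Fin 4) ℝ := T.map (fun z : ℤ => (z : ℝ)) with hTr
  have hTrdet : Tr.det = p := by
    have : Tr.det = ((T.det : ℤ) : ℝ) := (RingHom.map_det (Int.castRingHom ℝ) _).symm
    rw [this, hTdet]; simp
  have hinj : Function.Injective Tr.mulVec := by
    refine Matrix.mulVec_injective_iff_isUnit.2 ?_
    rw [Matrix.isUnit_iff_isUnit_det, hTrdet]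
    exact hp0.isUnit
  have hpd : ((p : ℝ)⁻¹ • (Trᵀ * S * Tr)).PosDef := by
    have := hS.conjTranspose_mul_mul_same hinj
    rw [conjTranspose_eq_transpose_of_trivial] at this
    exact this.smul (by have := hp.out.pos; positivity)
  refine det_ne_of_posDef_half (C := D) hpd ?_ ?_
  · have hTS : (2 : ℝ) • (Trᵀ * S * Tr) = (F + Fᵀ).map (fun z : ℤ => (z : ℝ)) := by
      have e1 : (2 : ℝ) • (Trᵀ * S * Tr) = Trᵀ * ((2 : ℝ) • S) * Tr := by simp
      have e2 : F + Fᵀ = Tᵀ * (C + Cᵀ) * T := by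
        rw [hF]; simp [Matrix.mul_add, Matrix.add_mul, Matrix.mul_assoc]
      rw [e1, hC, e2]
      have := Matrix.map_mul (L := Tᵀ * (C + Cᵀ)) (M := T) (f := Int.castRingHom ℝ)
      have h2 := Matrix.map_mul (L := Tᵀ) (M := (C + Cᵀ)) (f := Int.castRingHom ℝ)
      rw [h2] at this
      exact this.symm
    rw [smul_comm, hTS]
    ext i k
    rcases lt_trichotomy i k with h | rfl | h
    · have : (F i k + F k i : ℝ) = p * o i k := by exact_mod_cast ho i k
      simp [D, h.ne, h.ne', h, h.not_gt, this, hp0]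
    · have : (F i i : ℝ) = p * d i := by exact_mod_cast hd i
      simp [D, this]; field_simp
    · have : (F i k + F k i : ℝ) = p * o k i := by
        rw [add_comm]; exact_mod_cast ho k i
      simp [D, h.ne, h.ne', h, h.not_gt, this, hp0]
  -- The powers of `p` cancel: `p⁻⁴` from the scaling, `p²` from the index, `p²` from `S`.
  · rw [Matrix.det_smul, Matrix.det_mul, Matrix.det_mul, Matrix.det_transpose, hTrdet, hdet,
      Fintype.card_fin]
    field_simp

/-! ### Unimodular quaternary forms over `ℤ_q`, with `q = 2` included -/

/-- The change of basis matrix, with the basis vectors as columns. -/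
theorem exists_GL_of_basis {R : Type*} [CommRing R] {n : ℕ}
    (b : Module.Basis (Fin n) R (Fin n → R)) :
    ∃ X : Matrix.GeneralLinearGroup (Fin n) R, ∀ G : Matrix (Fin n) (Fin n) R, ∀ i j,
      ((X : Matrix (Fin n) (Fin n) R)ᵀ * G * (X : Matrix (Fin n) (Fin n) R)) i j
        = b i ⬝ᵥ (G *ᵥ b j) := by
  have hu : IsUnit ((Pi.basisFun R (Fin n)).toMatrix b) := by
    refine ⟨⟨(Pi.basisFun R (Fin n)).toMatrix b, b.toMatrix (Pi.basisFun R (Fin n)), ?_, ?_⟩, rfl⟩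
    · exact Module.Basis.toMatrix_mul_toMatrix_flip _ _
    · exact Module.Basis.toMatrix_mul_toMatrix_flip _ _
  refine ⟨hu.unit, fun G i j => ?_⟩
  have hcol : ∀ j, (fun i => (hu.unit : Matrix (Fin n) (Fin n) R) i j) = b j := fun j => by
    ext i; simp [Module.Basis.toMatrix_apply]
  rw [← hcol i, ← hcol j, Matrix.mul_assoc, Matrix.mul_apply_eq_vecMul]
  rfl

theorem eta_four {R : Type*} (M : Matrix (Fin 4) (Fin 4) R) :
    M = !![M 0 0, M 0 1, M 0 2, M 0 3; M 1 0, M 1 1, M 1 2, M 1 3;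
      M 2 0, M 2 1, M 2 2, M 2 3; M 3 0, M 3 1, M 3 2, M 3 3] := by
  ext i j; fin_cases i <;> fin_cases j <;> rfl

theorem det_hyperbolic_perp {R : Type*} [CommRing R] (a b c : R) :
    (!![0, 1, 0, 0; 1, 0, 0, 0; 0, 0, 2 * a, b; 0, 0, b, 2 * c]).det = b ^ 2 - 4 * a * c := by
  simp [Matrix.det_succ_row_zero, Fin.sum_univ_succ, Fin.succAbove]
  ring

/-- Chevalley–Warning: a quadratic form in four variables has a number of zeros divisible by `q`,
and 0 is one of them. -/
theorem zmod_exists_zero {q : ℕ} [hq : Fact q.Prime] (C : Matrix (Fin 4) (Fin 4) (ZMod q)) :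
    ∃ x : Fin 4 → ZMod q, x ≠ 0 ∧ x ⬝ᵥ (C *ᵥ x) = 0 := by
  classical
  set f : MvPolynomial (Fin 4) (ZMod q) := ∑ i, ∑ j,
    MvPolynomial.C (C i j) * (MvPolynomial.X i * MvPolynomial.X j) with hf
  have hev : ∀ x, MvPolynomial.eval x f = x ⬝ᵥ (C *ᵥ x) := fun x => by
    simp only [hf, map_sum, map_mul, MvPolynomial.eval_C, MvPolynomial.eval_X, dotProduct,
      Matrix.mulVec, Finset.mul_sum]
    exact Finset.sum_congr rfl fun i _ => Finset.sum_congr rfl fun j _ => by ring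
  have hdeg : f.totalDegree < Fintype.card (Fin 4) := by
    refine lt_of_le_of_lt (b := 2) ?_ (by simp)
    refine MvPolynomial.totalDegree_finsetSum_le fun i _ =>
      MvPolynomial.totalDegree_finsetSum_le fun j _ => ?_
    refine (MvPolynomial.totalDegree_mul _ _).trans ?_
    rw [MvPolynomial.totalDegree_C, zero_add]
    refine (MvPolynomial.totalDegree_mul _ _).trans ?_
    simp [MvPolynomial.totalDegree_X]
  have hdvd := char_dvd_card_solutions q hdeg
  have h1 : 1 < Fintype.card { x // MvPolynomial.eval x f = 0 } := by
    refine lt_of_lt_of_le hq.out.one_lt (Nat.le_of_dvd ?_ hdvd)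
    exact Fintype.card_pos_iff.2 ⟨⟨0, by rw [hev]; simp⟩⟩
  obtain ⟨⟨x, hx⟩, hne⟩ := Fintype.exists_ne_of_one_lt_card h1 ⟨0, by rw [hev]; simp⟩
  exact ⟨x, fun h => hne (Subtype.ext h), by rw [← hev]; exact hx⟩

theorem padicInt_isUnit_iff_toZMod {q : ℕ} [hq : Fact q.Prime] {x : ℤ_[q]} :
    IsUnit x ↔ PadicInt.toZMod x ≠ 0 := by
  rw [← not_iff_not, not_not, ← RingHom.mem_ker, PadicInt.ker_toZMod]
  rfl

/-- A nonzero zero `x` modulo `q` is nonsingular because the Gram matrix is invertible: some basis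
vector pairs with it to a unit. Hensel's lemma then applies along that direction. The derivative is
the polar form, so `q = 2` needs no separate treatment. -/
theorem exists_isotropic {q : ℕ} [hq : Fact q.Prime] (C : Matrix (Fin 4) (Fin 4) ℤ_[q])
    (hdet : IsUnit (C + Cᵀ).det) :
    ∃ e y : Fin 4 → ℤ_[q], e ⬝ᵥ (C *ᵥ e) = 0 ∧ IsUnit (e ⬝ᵥ ((C + Cᵀ) *ᵥ y)) := by
  obtain ⟨x', hx0, hx⟩ := zmod_exists_zero (C.map PadicInt.toZMod)
  have hsurj : Function.Surjective (PadicInt.toZMod (p := q)) := ZMod.ringHom_surjective _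
  choose x hxx using fun i => hsurj (x' i)
  have hxx' : PadicInt.toZMod ∘ x = x' := funext hxx
  have hG : ((C + Cᵀ).map PadicInt.toZMod) *ᵥ x' ≠ 0 := by
    intro h
    refine hx0 (Matrix.eq_zero_of_mulVec_eq_zero ?_ h)
    have := RingHom.map_det (PadicInt.toZMod (p := q)) (C + Cᵀ)
    rw [RingHom.mapMatrix_apply] at this
    rw [← this]
    exact padicInt_isUnit_iff_toZMod.1 hdet
  obtain ⟨k, hk⟩ := Function.ne_iff.1 hG
  have hku : IsUnit (((C + Cᵀ) *ᵥ x) k) := by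
    rw [padicInt_isUnit_iff_toZMod, RingHom.map_mulVec, hxx']
    exact hk
  set β := ((C + Cᵀ) *ᵥ x) k with hβ
  -- This is the value of the quadratic form at `x + t eₖ`, as a polynomial in `t`.
  set F : Polynomial ℤ_[q] := Polynomial.C (x ⬝ᵥ (C *ᵥ x)) + Polynomial.C β * Polynomial.X +
    Polynomial.C (C k k) * Polynomial.X ^ 2 with hF
  have hF0 : PadicInt.toZMod (x ⬝ᵥ (C *ᵥ x)) = 0 := by
    rw [RingHom.map_dotProduct, hxx']
    have : (PadicInt.toZMod ∘ (C *ᵥ x)) = C.map PadicInt.toZMod *ᵥ x' := by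
      ext i; simp only [Function.comp, RingHom.map_mulVec]; rw [hxx']
    rw [this, hx]
  have hnorm : ‖x ⬝ᵥ (C *ᵥ x)‖ < 1 := by
    rw [← PadicInt.mem_nonunits, mem_nonunits_iff, padicInt_isUnit_iff_toZMod, not_not, hF0]
  obtain ⟨t, ht, -, htd, -⟩ := hensels_lemma (F := F) (a := (0 : ℤ_[q])) (by
    simp [hF, PadicInt.isUnit_iff.1 hku]
    exact hnorm)
  have h1 : (Polynomial.aeval t) (Polynomial.derivative F) = β + 2 * t * C k k := by
    simp [hF]; ring
  have h0 : (Polynomial.aeval t) F = x ⬝ᵥ (C *ᵥ x) + β * t + C k k * t ^ 2 := by simp [hF]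
  have h2 : (Polynomial.aeval (0 : ℤ_[q])) (Polynomial.derivative F) = β := by
    simp [hF]
  rw [h1, h2, PadicInt.isUnit_iff.1 hku] at htd
  have hβ' : β = x ⬝ᵥ (C *ᵥ Pi.single k 1) + Pi.single k 1 ⬝ᵥ (C *ᵥ x) := by
    rw [hβ]
    simp only [Matrix.add_mulVec, Pi.add_apply, single_one_dotProduct, Matrix.mulVec_single_one]
    rw [add_comm]
    congr 1
    simp [Matrix.mulVec, dotProduct, mul_comm]
  refine ⟨x + t • Pi.single k 1, Pi.single k 1, ?_, ?_⟩
  · rw [← ht, h0, hβ']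
    simp only [Matrix.mulVec_add, Matrix.mulVec_smul, add_dotProduct, dotProduct_add,
      smul_dotProduct, dotProduct_smul, smul_eq_mul]
    simp
    ring
  · rw [PadicInt.isUnit_iff, ← htd, hβ']
    congr 1
    have e : ∀ y : Fin 4 → ℤ_[q], y ⬝ᵥ ((C + Cᵀ) *ᵥ Pi.single k 1) =
        y ⬝ᵥ (C *ᵥ Pi.single k 1) + Pi.single k 1 ⬝ᵥ (C *ᵥ y) := fun y => by
      rw [Matrix.add_mulVec, dotProduct_add, Matrix.mulVec_transpose, dotProduct_comm y (_ ᵥ* _),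
        ← Matrix.dotProduct_mulVec]
    rw [e]
    simp only [Matrix.mulVec_add, Matrix.mulVec_smul, add_dotProduct, dotProduct_add,
      smul_dotProduct, dotProduct_smul, smul_eq_mul]
    simp
    ring

/-- A hyperbolic pair extends to a basis whose remaining members are orthogonal to it. -/
theorem exists_basis_hyperbolic_pair {R M : Type*} [CommRing R] [IsDomain R]
    [IsPrincipalIdealRing R] [AddCommGroup M] [Module R M] [Module.Free R M] [Module.Finite R M]
    (B : LinearMap.BilinForm R M) (hB : ∀ x y, B x y = B y x) {e f : M}
    (hf : B f f = 0) (hef : B e f = 1) :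
    ∃ (k : ℕ) (b : Module.Basis (Fin (k + 2)) R M), b 0 = e ∧ b 1 = f ∧
      ∀ i : Fin k, B e (b i.succ.succ) = 0 ∧ B f (b i.succ.succ) = 0 := by
  have hfe : B f e = 1 := by rw [hB, hef]
  set N : Submodule R M := LinearMap.ker (B f) with hN
  set W : Submodule R M := LinearMap.ker (B e) ⊓ N with hW
  have hm : ∀ x ∈ W, B e x = 0 ∧ B f x = 0 := fun x hx => by
    simpa [hW, hN, Submodule.mem_inf] using hx
  set b₀ := Module.finBasis R W
  -- Subtracting `B e z • f` projects `N` onto `W`; similarly, subtracting `B f z • e` projects `M`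
  -- onto `N` for the next basis.
  set b₁ : Module.Basis (Fin (Module.finrank R W + 1)) R N :=
    Module.Basis.mkFinConsOfLE (O := N) f (by simp [hN, hf]) b₀ inf_le_right
      (fun c x hx h => by
        have := congrArg (B e) h
        simpa [hef, (hm x hx).1] using this)
      (fun z hz => ⟨- B e z, by
        have : B f z = 0 := hz
        simp [hW, hN, hef, hf, this]⟩)
  set b₂ : Module.Basis (Fin (Module.finrank R W + 1 + 1)) R M :=
    Module.Basis.mkFinCons e b₁ (fun c x hx h => by
        have h' := congrArg (B f) h
        have : B f x = 0 := hx
        simpa [hfe, this] using h')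
      (fun z => ⟨- B f z, by simp [hN, hfe]⟩)
  refine ⟨_, b₂, ?_, ?_, ?_⟩
  · simp [b₂]
  · rw [← Fin.succ_zero_eq_one]
    simp [b₂, b₁]
  · intro i
    have : b₂ i.succ.succ = (b₀ i : M) := by simp [b₂, b₁]
    rw [this]
    exact hm _ (b₀ i).2

theorem padicInt_isUnit_two {p : ℕ} [hp : Fact p.Prime] (h2 : p ≠ 2) : IsUnit (2 : ℤ_[p]) := by
  refine padicInt_isUnit_iff_toZMod.2 ?_
  rw [map_ofNat]
  intro h
  have : ((2 : ℕ) : ZMod p) = 0 := by exact_mod_cast h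
  rw [ZMod.natCast_eq_zero_iff] at this
  exact h2 ((Nat.prime_dvd_prime_iff_eq hp.out Nat.prime_two).1 this)

theorem padicInt_two_dvd_mul {q : ℕ} [hq : Fact q.Prime] {x y : ℤ_[q]} (h : (2 : ℤ_[q]) ∣ x * y) :
    (2 : ℤ_[q]) ∣ x ∨ (2 : ℤ_[q]) ∣ y := by
  by_cases h2 : q = 2
  · subst h2
    have := PadicInt.prime_p (p := 2)
    exact this.dvd_or_dvd (by exact_mod_cast h)
  · left
    exact (padicInt_isUnit_two h2).dvd

/-- The form `aX² + bXY + cY²` with discriminant `D²` factors as `(xX + yY)(zX + wY)`. With `u = (b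
+ D)/2`, the numbers `u` and `u - D` have sum `b` and product `ac`. They differ by the unit `D`, so
one of them is a unit and may be divided by. -/
theorem exists_binary_hyperbolic {q : ℕ} [hq : Fact q.Prime] {a b c D : ℤ_[q]} (hD : IsUnit D)
    (h : b ^ 2 - 4 * a * c = D ^ 2) :
    ∃ x y z w : ℤ_[q], IsUnit (x * w - y * z) ∧
      x * z = a ∧ x * w + y * z = b ∧ y * w = c := by
  obtain ⟨u, hu⟩ : (2 : ℤ_[q]) ∣ b + D := by
    have : (2 : ℤ_[q]) ∣ (b - D) * (b + D) := ⟨2 * a * c, by linear_combination h⟩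
    rcases padicInt_two_dvd_mul this with ⟨k, hk⟩ | h'
    · exact ⟨k + D, by linear_combination hk⟩
    · exact h'
  have huv : u * (u - D) = a * c := by
    have h4 : (4 : ℤ_[q]) ≠ 0 := by norm_num
    refine mul_left_cancel₀ h4 ?_
    have : b = 2 * u - D := by linear_combination hu
    rw [this] at h
    linear_combination h
  have hsum : u + (u - D) = b := by linear_combination -hu
  have key : ∀ u v : ℤ_[q], IsUnit u → IsUnit (u - v) → u * v = a * c → u + v = b →
      ∃ x y z w : ℤ_[q], IsUnit (x * w - y * z) ∧
      x * z = a ∧ x * w + y * z = b ∧ y * w = c := by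
    rintro u v ⟨u, rfl⟩ hD huv hs
    have hx : a * (↑u⁻¹ : ℤ_[q]) * c = v := by
      have : (↑u⁻¹ : ℤ_[q]) * u = 1 := Units.inv_mul u
      linear_combination (-(↑u⁻¹ : ℤ_[q])) * huv + v * this
    -- The factorization `(a u⁻¹ X + Y)(u X + c Y)`, whose determinant is `v - u`.
    refine ⟨a * (↑u⁻¹ : ℤ_[q]), 1, u, c, ?_, by simp, ?_, by simp⟩
    · rw [hx, one_mul, ← neg_sub, IsUnit.neg_iff]; exact hD
    · rw [hx]; linear_combination hs
  have hloc : IsUnit u ∨ IsUnit (-(u - D)) := by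
    refine IsLocalRing.isUnit_or_isUnit_of_isUnit_add ?_
    convert hD using 1; ring
  rcases hloc with hu | hu
  · exact key u (u - D) hu (by simpa using hD) huv hsum
  · exact key (u - D) u (by simpa using hu.neg) (by simpa using hD.neg)
      (by rw [← huv]; ring) (by rw [← hsum]; ring)

theorem exists_hyperbolic {q : ℕ} [hq : Fact q.Prime] (C : Matrix (Fin 4) (Fin 4) ℤ_[q])
    {d : ℤ_[q]} (hd : IsUnit d) (hdet : (C + Cᵀ).det = d ^ 2) :
    ∃ X : Matrix.GeneralLinearGroup (Fin 4) ℤ_[q],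
      (X : Matrix (Fin 4) (Fin 4) ℤ_[q])ᵀ * (C + Cᵀ) * (X : Matrix (Fin 4) (Fin 4) ℤ_[q]) =
        !![0, 1, 0, 0; 1, 0, 0, 0; 0, 0, 0, 1; 0, 0, 1, 0] := by
  set G := C + Cᵀ with hG
  have hGs : Gᵀ = G := by rw [hG, transpose_add, transpose_transpose, add_comm]
  set B : LinearMap.BilinForm ℤ_[q] (Fin 4 → ℤ_[q]) := Matrix.toBilin' G with hBdef
  have hBa : ∀ x y, B x y = x ⬝ᵥ (G *ᵥ y) := fun x y => Matrix.toBilin'_apply' G x y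
  have hB : ∀ x y, B x y = B y x := fun x y => by
    rw [hBa, hBa, Matrix.dotProduct_mulVec, dotProduct_comm, ← Matrix.mulVec_transpose, hGs]
  have hQ : ∀ x, B x x = 2 * (x ⬝ᵥ (C *ᵥ x)) := fun x => by
    rw [hBa, hG, Matrix.add_mulVec, dotProduct_add, Matrix.mulVec_transpose,
      dotProduct_comm x (_ ᵥ* _), ← Matrix.dotProduct_mulVec]
    ring
  obtain ⟨e, y, he, hy⟩ := exists_isotropic C (by rw [← hG, hdet]; exact hd.pow 2)
  rw [← hG, ← hBa] at hy
  obtain ⟨w, hw⟩ := hy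
  set g : Fin 4 → ℤ_[q] := (↑w⁻¹ : ℤ_[q]) • y with hgdef
  have hee : B e e = 0 := by rw [hQ, he, mul_zero]
  have heg : B e g = 1 := by simp [hgdef, ← hw]
  -- Subtracting the value of the quadratic form at `g` times `e` makes `f` isotropic without
  -- dividing by 2.
  set f : Fin 4 → ℤ_[q] := g - (g ⬝ᵥ (C *ᵥ g)) • e with hfdef
  have hef : B e f = 1 := by simp [hfdef, hee, heg]
  have hff : B f f = 0 := by
    simp only [hfdef, map_sub, map_smul, LinearMap.sub_apply, LinearMap.smul_apply, hee, heg,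
      hB g e, hQ g, smul_eq_mul]
    ring
  obtain ⟨k, b, hb0, hb1, hb⟩ := exists_basis_hyperbolic_pair B hB hff hef
  obtain rfl : k = 2 := by
    have := Module.finrank_eq_card_basis b
    simp at this
    omega
  obtain ⟨X, hX⟩ := exists_GL_of_basis b
  have hb02 := (hb 0).1
  have hb03 := (hb 1).1
  have hb12 := (hb 0).2
  have hb13 := (hb 1).2
  change B e (b 2) = 0 at hb02
  change B e (b 3) = 0 at hb03
  change B f (b 2) = 0 at hb12
  change B f (b 3) = 0 at hb13
  set a₂ := (b 2) ⬝ᵥ (C *ᵥ (b 2))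
  set c₂ := (b 3) ⬝ᵥ (C *ᵥ (b 3))
  set b₂ := B (b 2) (b 3) with hb₂
  have hgram : (X : Matrix (Fin 4) (Fin 4) ℤ_[q])ᵀ * G * (X : Matrix (Fin 4) (Fin 4) ℤ_[q]) =
      !![0, 1, 0, 0; 1, 0, 0, 0; 0, 0, 2 * a₂, b₂; 0, 0, b₂, 2 * c₂] := by
    have hfe : B f e = 1 := (hB f e).trans hef
    have h20 : B (b 2) e = 0 := (hB _ _).trans hb02
    have h30 : B (b 3) e = 0 := (hB _ _).trans hb03
    have h21 : B (b 2) f = 0 := (hB _ _).trans hb12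
    have h31 : B (b 3) f = 0 := (hB _ _).trans hb13
    have h32 : B (b 3) (b 2) = b₂ := hB _ _
    have h22 : B (b 2) (b 2) = 2 * a₂ := hQ _
    have h33 : B (b 3) (b 3) = 2 * c₂ := hQ _
    rw [← hb0] at hee hef hfe hb02 hb03 h20 h30
    rw [← hb1] at hff hef hfe hb12 hb13 h21 h31
    rw [eta_four ((X : Matrix (Fin 4) (Fin 4) ℤ_[q])ᵀ * G * (X : Matrix (Fin 4) (Fin 4) ℤ_[q]))]
    simp only [hX, ← hBa, hee, hef, hb02, hb03, hfe, hff, hb12, hb13, h20, h21, h22, h30, h31,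
      h32, h33]
    rfl
  have hXu : IsUnit (X : Matrix (Fin 4) (Fin 4) ℤ_[q]).det :=
    (Matrix.isUnit_iff_isUnit_det _).1 X.isUnit
  have hdd := congrArg Matrix.det hgram
  rw [det_mul, det_mul, det_transpose, hdet] at hdd
  have hdisc : b₂ ^ 2 - 4 * a₂ * c₂ = ((X : Matrix (Fin 4) (Fin 4) ℤ_[q]).det * d) ^ 2 := by
    rw [det_hyperbolic_perp] at hdd
    linear_combination -hdd
  obtain ⟨x, y, z, w, hu, h1, h2, h3⟩ := exists_binary_hyperbolic (hXu.mul hd) hdisc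
  set P : Matrix (Fin 4) (Fin 4) ℤ_[q] := !![1, 0, 0, 0; 0, 1, 0, 0; 0, 0, x, y; 0, 0, z, w]
    with hP
  have hPu : IsUnit P := by
    rw [Matrix.isUnit_iff_isUnit_det]
    convert hu using 1
    simp [hP, Matrix.det_succ_row_zero, Fin.sum_univ_succ, Fin.succAbove]
    ring
  obtain ⟨P', hP'⟩ := hPu
  have hfac : !![0, 1, 0, 0; 1, 0, 0, 0; 0, 0, 2 * a₂, b₂; 0, 0, b₂, 2 * c₂] =
      Pᵀ * !![0, 1, 0, 0; 1, 0, 0, 0; 0, 0, 0, 1; 0, 0, 1, 0] * P := by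
    rw [← h1, ← h2, ← h3, hP]
    ext i j
    fin_cases i <;> fin_cases j <;>
      simp [Matrix.mul_apply, Fin.sum_univ_four] <;> ring
  refine ⟨X * P'⁻¹, ?_⟩
  have hPi : P * ((P'⁻¹ : Matrix.GeneralLinearGroup (Fin 4) ℤ_[q]) : Matrix (Fin 4) (Fin 4) ℤ_[q])
      = 1 := by
    rw [← hP']; exact Units.mul_inv P'
  rw [Units.val_mul, transpose_mul]
  calc _ = ((P'⁻¹ : Matrix.GeneralLinearGroup (Fin 4) ℤ_[q]) : Matrix (Fin 4) (Fin 4) ℤ_[q])ᵀ *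
        ((X : Matrix (Fin 4) (Fin 4) ℤ_[q])ᵀ * G * (X : Matrix (Fin 4) (Fin 4) ℤ_[q])) *
        ((P'⁻¹ : Matrix.GeneralLinearGroup (Fin 4) ℤ_[q]) : Matrix (Fin 4) (Fin 4) ℤ_[q]) := by
        simp only [Matrix.mul_assoc]
    _ = (P * ((P'⁻¹ : Matrix.GeneralLinearGroup (Fin 4) ℤ_[q]) :
          Matrix (Fin 4) (Fin 4) ℤ_[q]))ᵀ * !![0, 1, 0, 0; 1, 0, 0, 0; 0, 0, 0, 1; 0, 0, 1, 0] *
        (P * ((P'⁻¹ : Matrix.GeneralLinearGroup (Fin 4) ℤ_[q]) :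
          Matrix (Fin 4) (Fin 4) ℤ_[q])) := by
        rw [hgram, hfac, transpose_mul]
        simp only [Matrix.mul_assoc]
    _ = _ := by rw [hPi]; simp

/-! ### Diagonal forms over `ℤ_p` for odd `p` -/

theorem padicInt_isSquare {p : ℕ} [hp : Fact p.Prime] (h2 : p ≠ 2) {x : ℤ_[p]} (hx : IsUnit x)
    (h : IsSquare (PadicInt.toZMod x)) : IsSquare x := by
  obtain ⟨y', hy'⟩ := h
  obtain ⟨y, rfl⟩ := ZMod.ringHom_surjective (PadicInt.toZMod (p := p)) y'
  have hy : IsUnit y := by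
    rw [padicInt_isUnit_iff_toZMod] at hx ⊢
    rintro h
    rw [h] at hy'
    exact hx (by rw [hy', mul_zero])
  have hnorm : ‖y ^ 2 - x‖ < 1 := by
    rw [← PadicInt.mem_nonunits, mem_nonunits_iff, padicInt_isUnit_iff_toZMod, not_not, map_sub,
      hy', map_pow]
    ring
  have hd : ‖2 * y‖ = 1 := PadicInt.isUnit_iff.1 ((padicInt_isUnit_two h2).mul hy)
  obtain ⟨z, hz, -⟩ := hensels_lemma (F := (Polynomial.X ^ 2 - Polynomial.C x : Polynomial ℤ_[p]))
    (a := y) (by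
      have e : (Polynomial.aeval y) (Polynomial.derivative
          (Polynomial.X ^ 2 - Polynomial.C x : Polynomial ℤ_[p])) = 2 * y := by
        simp [one_add_one_eq_two]
      rw [e, hd]
      simpa using hnorm)
  refine ⟨z, ?_⟩
  simp at hz
  linear_combination -hz

theorem padicInt_isSquare_mul {p : ℕ} [hp : Fact p.Prime] (h2 : p ≠ 2) {x y : ℤ_[p]}
    (hx : IsUnit x) (hy : IsUnit y) (hxs : ¬ IsSquare x) (hys : ¬ IsSquare y) :
    IsSquare (x * y) := by
  refine padicInt_isSquare h2 (hx.mul hy) ?_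
  rw [map_mul]
  exact isSquare_mul_of_not_isSquare (fun h => hxs (padicInt_isSquare h2 hx h))
    (fun h => hys (padicInt_isSquare h2 hy h))

/-- A solution modulo `p` exists by counting, and one of its coordinates is nonzero. With the other
coordinate fixed, the equation asks for a square root of a unit that is a square modulo `p`. -/
theorem padicInt_exists_binary_one {p : ℕ} [hp : Fact p.Prime] (h2 : p ≠ 2) {a b : ℤ_[p]}
    (ha : IsUnit a) (hb : IsUnit b) : ∃ x y : ℤ_[p], a * x ^ 2 + b * y ^ 2 = 1 := by
  have key : ∀ (a b y : ℤ_[p]) (x' : ZMod p), IsUnit a → x' ≠ 0 →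
      PadicInt.toZMod a * x' ^ 2 + PadicInt.toZMod b * (PadicInt.toZMod y) ^ 2 = 1 →
      ∃ x y : ℤ_[p], a * x ^ 2 + b * y ^ 2 = 1 := by
    rintro a b y x' ⟨a, rfl⟩ hx' h
    have ha0 := padicInt_isUnit_iff_toZMod.1 a.isUnit
    have hinv : PadicInt.toZMod (a : ℤ_[p]) * PadicInt.toZMod (↑a⁻¹ : ℤ_[p]) = 1 := by
      rw [← map_mul]; simp
    have hz : PadicInt.toZMod ((↑a⁻¹ : ℤ_[p]) * (1 - b * y ^ 2)) = x' * x' := by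
      simp only [map_mul, map_sub, map_one, map_pow]
      linear_combination (-PadicInt.toZMod (↑a⁻¹ : ℤ_[p])) * h + x' ^ 2 * hinv
    obtain ⟨x, hx⟩ := padicInt_isSquare h2 (x := (↑a⁻¹ : ℤ_[p]) * (1 - b * y ^ 2))
      (padicInt_isUnit_iff_toZMod.2 (by rw [hz]; exact mul_ne_zero hx' hx')) ⟨x', hz⟩
    refine ⟨x, y, ?_⟩
    have : (a : ℤ_[p]) * (↑a⁻¹ : ℤ_[p]) = 1 := by simp
    linear_combination (-(a : ℤ_[p])) * hx + (1 - b * y ^ 2) * this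
  have ha0 := padicInt_isUnit_iff_toZMod.1 ha
  have hb0 := padicInt_isUnit_iff_toZMod.1 hb
  obtain ⟨x', y', h⟩ := FiniteField.exists_root_sum_quadratic (R := ZMod p)
    (f := Polynomial.C (PadicInt.toZMod a) * Polynomial.X ^ 2 + Polynomial.C 0 * Polynomial.X +
      Polynomial.C (-1))
    (g := Polynomial.C (PadicInt.toZMod b) * Polynomial.X ^ 2 + Polynomial.C 0 * Polynomial.X +
      Polynomial.C 0)
    (Polynomial.degree_quadratic ha0) (Polynomial.degree_quadratic hb0)
    (by rw [ZMod.card]; exact hp.out.eq_two_or_odd.resolve_left h2)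
  obtain ⟨x, rfl⟩ := ZMod.ringHom_surjective (PadicInt.toZMod (p := p)) x'
  obtain ⟨y, rfl⟩ := ZMod.ringHom_surjective (PadicInt.toZMod (p := p)) y'
  simp only [Polynomial.eval_add, Polynomial.eval_mul, Polynomial.eval_C, Polynomial.eval_pow,
    Polynomial.eval_X] at h
  by_cases hx0 : PadicInt.toZMod x = 0
  · have hy0 : PadicInt.toZMod y ≠ 0 := by
      intro hy0
      rw [hx0, hy0] at h
      simp at h
    obtain ⟨u, v, huv⟩ := key b a x _ hb hy0 (by linear_combination h)
    exact ⟨v, u, by linear_combination huv⟩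
  · exact key a b y _ ha hx0 (by linear_combination h)

theorem padicInt_dvd_total {p : ℕ} [hp : Fact p.Prime] {x y : ℤ_[p]} (hx : x ≠ 0)
    (h : y ≠ 0 → x.valuation ≤ y.valuation) : x ∣ y := by
  by_cases hy : y = 0
  · rw [hy]; exact dvd_zero _
  · obtain ⟨k, hk⟩ := Nat.exists_eq_add_of_le (h hy)
    rw [PadicInt.unitCoeff_spec hx, PadicInt.unitCoeff_spec hy, hk, pow_add]
    refine ⟨(↑(PadicInt.unitCoeff hx)⁻¹ : ℤ_[p]) * PadicInt.unitCoeff hy * (p : ℤ_[p]) ^ k, ?_⟩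
    have : (PadicInt.unitCoeff hx : ℤ_[p]) * (↑(PadicInt.unitCoeff hx)⁻¹ : ℤ_[p]) = 1 := by simp
    linear_combination (-(p : ℤ_[p]) ^ x.valuation * PadicInt.unitCoeff hy * (p : ℤ_[p]) ^ k) * this

/-- Symmetric bilinear forms over `ℤ_p`, `p` odd, are diagonalizable. -/
theorem padicInt_exists_orthogonal_basis {p : ℕ} [hp : Fact p.Prime] (h2 : p ≠ 2) (n : ℕ) :
    ∀ {M : Type} [AddCommGroup M] [Module ℤ_[p] M] [Module.Free ℤ_[p] M]
    [Module.Finite ℤ_[p] M] (B : LinearMap.BilinForm ℤ_[p] M), (∀ x y, B x y = B y x) →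
    Module.finrank ℤ_[p] M = n →
    ∃ b : Module.Basis (Fin n) ℤ_[p] M, ∀ i j, i ≠ j → B (b i) (b j) = 0 := by
  induction n with
  | zero =>
    intro M _ _ _ _ B hB hn
    exact ⟨Module.finBasisOfFinrankEq _ _ hn, fun i => i.elim0⟩
  | succ n ih =>
    intro M _ _ _ _ B hB hn
    have h2u := padicInt_isUnit_two h2
    by_cases h0 : ∀ x, B x x = 0
    · refine ⟨Module.finBasisOfFinrankEq _ _ hn, fun i j _ => ?_⟩
      set x := Module.finBasisOfFinrankEq _ _ hn i
      set y := Module.finBasisOfFinrankEq _ _ hn j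
      have h := h0 (x + y)
      simp only [map_add, LinearMap.add_apply, h0 x, h0 y, hB y x] at h
      refine h2u.mul_right_eq_zero.1 (?_ : (2 : ℤ_[p]) * B x y = 0)
      linear_combination h
    · push Not at h0
      -- For `v` of minimal valuation, `B v v` divides every `B x x`, and by polarization every `B v
      -- x`, since 2 is a unit; hence `v` splits off orthogonally.
      obtain ⟨v, hv0, hv⟩ : ∃ v, B v v ≠ 0 ∧ ∀ x, B x x ≠ 0 →
          (B v v).valuation ≤ (B x x).valuation := by
        obtain ⟨v, hv, hmin⟩ := WellFounded.has_min
          (InvImage.wf (fun x : M => (B x x).valuation) Nat.lt_wfRel.wf) {x | B x x ≠ 0} h0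
        exact ⟨v, hv, fun x hx => not_lt.1 (hmin x hx)⟩
      have hdvd : ∀ x, B v v ∣ B x x := fun x => padicInt_dvd_total hv0 (hv x)
      have hdvd2 : ∀ x, B v v ∣ B v x := fun x => by
        have h : B v v ∣ B v x * 2 := by
          have e : B v x * 2 = B (v + x) (v + x) - B v v - B x x := by
            simp only [map_add, LinearMap.add_apply, hB x v]; ring
          rw [e]
          exact dvd_sub (dvd_sub (hdvd _) dvd_rfl) (hdvd _)
        exact (h2u.dvd_mul_right).1 h
      set W : Submodule ℤ_[p] M := LinearMap.ker (B v) with hW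
      have hbase : ∀ {k : ℕ} (b₀ : Module.Basis (Fin k) ℤ_[p] W),
          ∃ b : Module.Basis (Fin (k + 1)) ℤ_[p] M, b 0 = v ∧ ∀ i, b (Fin.succ i) = b₀ i := by
        intro k b₀
        refine ⟨Module.Basis.mkFinCons v b₀ (fun c x hx h => ?_) (fun z => ?_), ?_, ?_⟩
        · have h' := congrArg (B v) h
          have hx' : B v x = 0 := hx
          simpa [hx', hv0] using h'
        · obtain ⟨c, hc⟩ := hdvd2 z
          exact ⟨-c, by simp [hW, hc, mul_comm]⟩
        · simp
        · simp
      have hk : Module.finrank ℤ_[p] W = n := by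
        obtain ⟨b, -⟩ := hbase (Module.finBasis ℤ_[p] W)
        have := Module.finrank_eq_card_basis b
        rw [hn, Fintype.card_fin] at this
        omega
      obtain ⟨b₀, hb₀⟩ := ih (B.restrict W) (fun x y => hB x y) hk
      obtain ⟨b, hbv, hb⟩ := hbase b₀
      refine ⟨b, fun i j hij => ?_⟩
      have hvW : ∀ i, B v (b₀ i) = 0 := fun i => (b₀ i).2
      induction i using Fin.cases with
      | zero =>
        induction j using Fin.cases with
        | zero => exact absurd rfl hij
        | succ j => rw [hbv, hb]; exact hvW j
      | succ i =>
        induction j using Fin.cases with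
        | zero => rw [hbv, hb, hB]; exact hvW i
        | succ j => rw [hb, hb]; exact hb₀ i j (fun h => hij (by rw [h]))

theorem exists_perm_of_card_eq_two : ∀ s : Finset (Fin 4), s.card = 2 →
    ∃ σ : Equiv.Perm (Fin 4), σ 0 ∉ s ∧ σ 1 ∉ s ∧ σ 2 ∈ s ∧ σ 3 ∈ s := by
  decide

/-- A symmetric matrix of degree `4` over `ℤ_p`, `p` odd, that divides `p` and has determinant
`p²` times a unit has two unit and two `p`-modular diagonal entries. -/
theorem padicInt_exists_diag {p : ℕ} [hp : Fact p.Prime] (h2 : p ≠ 2)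
    {A T : Matrix (Fin 4) (Fin 4) ℤ_[p]} (hA : Aᵀ = A) (hT : A * T = (p : ℤ_[p]) • 1)
    {w : ℤ_[p]} (hw : IsUnit w) (hdet : A.det = (p : ℤ_[p]) ^ 2 * w) :
    ∃ (X : Matrix.GeneralLinearGroup (Fin 4) ℤ_[p]) (a b c d : ℤ_[p]),
      IsUnit a ∧ IsUnit b ∧ IsUnit c ∧ IsUnit d ∧
      (X : Matrix (Fin 4) (Fin 4) ℤ_[p])ᵀ * A * (X : Matrix (Fin 4) (Fin 4) ℤ_[p]) =
        Matrix.diagonal ![a, b, p * c, p * d] := by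
  have hpp : Prime (p : ℤ_[p]) := PadicInt.prime_p
  obtain ⟨b, hb⟩ := padicInt_exists_orthogonal_basis h2 4 (Matrix.toBilin' A)
    (fun x y => by
      rw [Matrix.toBilin'_apply', Matrix.toBilin'_apply', Matrix.dotProduct_mulVec,
        dotProduct_comm, ← Matrix.mulVec_transpose, hA]) (by simp)
  have hform : ∀ b' : Module.Basis (Fin 4) ℤ_[p] (Fin 4 → ℤ_[p]),
      (∀ i j, i ≠ j → Matrix.toBilin' A (b' i) (b' j) = 0) →
      ∃ X : Matrix.GeneralLinearGroup (Fin 4) ℤ_[p],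
      (X : Matrix (Fin 4) (Fin 4) ℤ_[p])ᵀ * A * (X : Matrix (Fin 4) (Fin 4) ℤ_[p]) =
        Matrix.diagonal (fun i => Matrix.toBilin' A (b' i) (b' i)) := by
    intro b' hb'
    obtain ⟨X, hX⟩ := exists_GL_of_basis b'
    refine ⟨X, ?_⟩
    ext i j
    rw [hX, ← Matrix.toBilin'_apply']
    by_cases hij : i = j
    · subst hij; simp
    · rw [hb' i j hij, Matrix.diagonal_apply_ne _ hij]
  set d : Fin 4 → ℤ_[p] := fun i => Matrix.toBilin' A (b i) (b i) with hd
  obtain ⟨X, hX⟩ := hform b hb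
  have hXX : (X : Matrix (Fin 4) (Fin 4) ℤ_[p]) *
      ((X⁻¹ : Matrix.GeneralLinearGroup (Fin 4) ℤ_[p]) : Matrix (Fin 4) (Fin 4) ℤ_[p]) = 1 :=
    Units.mul_inv X
  -- The relation `A * T = p` becomes `diagonal d * (integral matrix) = p` in the new basis.
  have hdvd : ∀ i, d i ∣ p := by
    intro i
    set Y := ((X⁻¹ : Matrix.GeneralLinearGroup (Fin 4) ℤ_[p]) : Matrix (Fin 4) (Fin 4) ℤ_[p])
    have hYX : Y * (X : Matrix (Fin 4) (Fin 4) ℤ_[p]) = 1 := Units.inv_mul X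
    have h : Matrix.diagonal d * (Y * T * Yᵀ) = (p : ℤ_[p]) • 1 := by
      rw [← hX]
      calc _ = (X : Matrix (Fin 4) (Fin 4) ℤ_[p])ᵀ * (A *
            (((X : Matrix (Fin 4) (Fin 4) ℤ_[p]) * Y) * T)) * Yᵀ := by
            simp only [Matrix.mul_assoc]
        _ = (p : ℤ_[p]) • ((Y * (X : Matrix (Fin 4) (Fin 4) ℤ_[p]))ᵀ) := by
            rw [hXX, Matrix.one_mul, hT, transpose_mul]; simp
        _ = _ := by rw [hYX, transpose_one]
    have h' := congrFun (congrFun h i) i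
    rw [Matrix.diagonal_mul] at h'
    exact ⟨_, by rw [h']; simp⟩
  have hdu : ∀ i, ¬ IsUnit (d i) → ∃ c, IsUnit c ∧ d i = p * c := by
    intro i hi
    obtain ⟨e, he⟩ := hdvd i
    rcases hpp.irreducible.isUnit_or_isUnit he with h | ⟨e, rfl⟩
    · exact absurd h hi
    · exact ⟨(↑e⁻¹ : ℤ_[p]), e⁻¹.isUnit, by rw [he, mul_assoc]; simp⟩
  classical
  set s : Finset (Fin 4) := Finset.univ.filter fun i => ¬ IsUnit (d i) with hs
  have hprod : ∏ i, d i = (X : Matrix (Fin 4) (Fin 4) ℤ_[p]).det ^ 2 * w * (p : ℤ_[p]) ^ 2 := by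
    rw [← Matrix.det_diagonal, ← hX, det_mul, det_mul, det_transpose, hdet]; ring
  have hXu : IsUnit (X : Matrix (Fin 4) (Fin 4) ℤ_[p]).det :=
    (Matrix.isUnit_iff_isUnit_det _).1 X.isUnit
  -- Each nonunit `d i` is `p` times a unit, so the `p`-adic valuation of the determinant counts
  -- them.
  have hcard : s.card = 2 := by
    have h1 : ∃ u, IsUnit u ∧ ∏ i, d i = u * (p : ℤ_[p]) ^ s.card := by
      have : ∀ i, ∃ c, IsUnit c ∧ d i = c * (if i ∈ s then (p : ℤ_[p]) else 1) := by
        intro i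
        by_cases hi : IsUnit (d i)
        · exact ⟨d i, hi, by simp [hs, hi]⟩
        · obtain ⟨c, hc, h⟩ := hdu i hi
          refine ⟨c, hc, ?_⟩
          rw [if_pos (by simp [hs, hi]), h, mul_comm]
      choose c hc h using this
      refine ⟨∏ i, c i, IsUnit.prod_univ_iff.2 hc, ?_⟩
      rw [Finset.prod_congr rfl fun i _ => h i, Finset.prod_mul_distrib]
      congr 1
      simp
    obtain ⟨u, hu, h⟩ := h1
    rw [hprod] at h
    have d1 : (p : ℤ_[p]) ^ 2 ∣ (p : ℤ_[p]) ^ s.card :=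
      (hu.dvd_mul_left).1 (h ▸ Dvd.intro_left _ rfl)
    have d2 : (p : ℤ_[p]) ^ s.card ∣ (p : ℤ_[p]) ^ 2 :=
      (((hXu.pow 2).mul hw).dvd_mul_left).1 (h.symm ▸ Dvd.intro_left _ rfl)
    rw [pow_dvd_pow_iff hpp.ne_zero hpp.not_isUnit] at d1 d2
    omega
  obtain ⟨σ, h0, h1, h2', h3⟩ := exists_perm_of_card_eq_two s hcard
  obtain ⟨X', hX'⟩ := hform (b.reindex σ.symm) (fun i j hij => by
    simp only [Module.Basis.reindex_apply, Equiv.symm_symm]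
    exact hb _ _ (fun h => hij (σ.injective h)))
  simp only [Module.Basis.reindex_apply, Equiv.symm_symm] at hX'
  simp only [hs, Finset.mem_filter, Finset.mem_univ, true_and, not_not] at h0 h1 h2' h3
  obtain ⟨c, hc, hc'⟩ := hdu _ h2'
  obtain ⟨e, he, he'⟩ := hdu _ h3
  refine ⟨X', d (σ 0), d (σ 1), c, e, h0, h1, hc, he, ?_⟩
  rw [hX', ← hc', ← he']
  congr 1
  ext i
  fin_cases i <;> rfl

/-- If `⟨a, b⟩` takes the value 1 at `(x, y)`, then `(-by, ax)` is orthogonal to that vector, has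
value `ab`, and completes it to a basis of determinant 1. The same is done on the `p`-modular block.
-/
theorem exists_GL_diagonal_one {R : Type*} [CommRing R] {a b c d p x y z w : R}
    (h₁ : a * x ^ 2 + b * y ^ 2 = 1) (h₂ : c * z ^ 2 + d * w ^ 2 = 1) :
    ∃ X : Matrix.GeneralLinearGroup (Fin 4) R,
      (X : Matrix (Fin 4) (Fin 4) R)ᵀ * Matrix.diagonal ![a, b, p * c, p * d] *
        (X : Matrix (Fin 4) (Fin 4) R) = Matrix.diagonal ![1, a * b, p, p * (c * d)] := by
  set Y : Matrix (Fin 4) (Fin 4) R :=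
    !![x, -b * y, 0, 0; y, a * x, 0, 0; 0, 0, z, -d * w; 0, 0, w, c * z] with hY
  have hdet : Y.det = 1 := by
    have : Y.det = (a * x ^ 2 + b * y ^ 2) * (c * z ^ 2 + d * w ^ 2) := by
      simp [hY, Matrix.det_succ_row_zero, Fin.sum_univ_succ, Fin.succAbove]
      ring
    rw [this, h₁, h₂, one_mul]
  have hYu : IsUnit Y := by
    rw [Matrix.isUnit_iff_isUnit_det, hdet]; exact isUnit_one
  refine ⟨hYu.unit, ?_⟩
  have hgram : Yᵀ * Matrix.diagonal ![a, b, p * c, p * d] * Y =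
      !![a * x ^ 2 + b * y ^ 2, 0, 0, 0; 0, a * b * (a * x ^ 2 + b * y ^ 2), 0, 0;
        0, 0, p * (c * z ^ 2 + d * w ^ 2), 0; 0, 0, 0, p * (c * d) * (c * z ^ 2 + d * w ^ 2)] := by
    rw [hY]
    ext i j
    fin_cases i <;> fin_cases j <;>
      simp [Matrix.mul_apply, Fin.sum_univ_four, Matrix.diagonal_apply] <;> ring
  rw [IsUnit.unit_spec, hgram, h₁, h₂]
  ext i j
  fin_cases i <;> fin_cases j <;> simp

/-- If `A[X] = 1 ⊥ δ ⊥ p (1 ⊥ δ')` with `-δ` a square, the form `A` is modulo `p` a multiple of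
a nonzero linear form. -/
theorem exists_linear_form {p : ℕ} [hp : Fact p.Prime] {A : Matrix (Fin 4) (Fin 4) ℤ_[p]}
    {X : Matrix.GeneralLinearGroup (Fin 4) ℤ_[p]} {t δ : ℤ_[p]}
    (hX : (X : Matrix (Fin 4) (Fin 4) ℤ_[p])ᵀ * A * (X : Matrix (Fin 4) (Fin 4) ℤ_[p]) =
      Matrix.diagonal ![1, -(t * t), (p : ℤ_[p]), p * δ]) :
    ∃ (a : Fin 4 → ℤ) (j : Fin 4), ¬ (p : ℤ) ∣ a j ∧ ∀ x : Fin 4 → ℤ, (p : ℤ) ∣ a ⬝ᵥ x →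
      PadicInt.toZMod ((fun i => (x i : ℤ_[p])) ⬝ᵥ (A *ᵥ fun i => (x i : ℤ_[p]))) = 0 := by
  set Y := ((X⁻¹ : Matrix.GeneralLinearGroup (Fin 4) ℤ_[p]) : Matrix (Fin 4) (Fin 4) ℤ_[p])
  have hYX : Y * (X : Matrix (Fin 4) (Fin 4) ℤ_[p]) = 1 := Units.inv_mul X
  have hXY : (X : Matrix (Fin 4) (Fin 4) ℤ_[p]) * Y = 1 := Units.mul_inv X
  -- The factor `y₀ - t y₁` of `y₀² - t² y₁²`, written in the original coordinates.
  set l : Fin 4 → ℤ_[p] := ![1, -t, 0, 0] ᵥ* Y with hl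
  have hlX : l ᵥ* (X : Matrix (Fin 4) (Fin 4) ℤ_[p]) = ![1, -t, 0, 0] := by
    rw [hl, Matrix.vecMul_vecMul, hYX, Matrix.vecMul_one]
  obtain ⟨j, hj⟩ : ∃ j, PadicInt.toZMod (l j) ≠ 0 := by
    by_contra! h
    have h0 := congrArg PadicInt.toZMod (congrFun hlX 0)
    simp [Matrix.vecMul, dotProduct, h] at h0
  choose a ha using fun i => ZMod.intCast_surjective (PadicInt.toZMod (l i))
  refine ⟨a, j, ?_, fun x hx => ?_⟩
  · rwa [← ZMod.intCast_zmod_eq_zero_iff_dvd, ha]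
  · set v : Fin 4 → ℤ_[p] := fun i => (x i : ℤ_[p]) with hv
    have hlv : PadicInt.toZMod (l ⬝ᵥ v) = 0 := by
      rw [← ZMod.intCast_zmod_eq_zero_iff_dvd] at hx
      rw [← hx]
      simp [dotProduct, hv, ha]
    set y := Y *ᵥ v with hy
    have hly : l ⬝ᵥ v = y 0 - t * y 1 := by
      rw [hl, ← Matrix.dotProduct_mulVec, ← hy]
      simp [dotProduct, Fin.sum_univ_four]; ring
    have hvy : v = (X : Matrix (Fin 4) (Fin 4) ℤ_[p]) *ᵥ y := by
      rw [hy, Matrix.mulVec_mulVec, hXY, Matrix.one_mulVec]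
    have hval : v ⬝ᵥ (A *ᵥ v) =
        (y 0 - t * y 1) * (y 0 + t * y 1) + p * (y 2 ^ 2 + δ * y 3 ^ 2) := by
      have : v ⬝ᵥ (A *ᵥ v) = y ⬝ᵥ (((X : Matrix (Fin 4) (Fin 4) ℤ_[p])ᵀ * A *
          (X : Matrix (Fin 4) (Fin 4) ℤ_[p])) *ᵥ y) := by
        rw [← Matrix.mulVec_mulVec, ← Matrix.mulVec_mulVec, ← hvy, Matrix.dotProduct_mulVec y,
          Matrix.vecMul_transpose, ← hvy]
      rw [this, hX]
      simp [dotProduct, Matrix.mulVec_diagonal, Fin.sum_univ_four]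
      ring
    rw [hval, ← hly, map_add, map_mul, hlv, map_mul]
    simp

/-! ### Passage to the stated local forms -/

theorem perp_two_two {K : Type*} [CommRing K] (X Y : Matrix (Fin 2) (Fin 2) K) :
    QuadMat.perp X Y = !![X 0 0, X 0 1, 0, 0; X 1 0, X 1 1, 0, 0;
      0, 0, Y 0 0, Y 0 1; 0, 0, Y 1 0, Y 1 1] := by
  ext i j; fin_cases i <;> fin_cases j <;> rfl

theorem perp_one_one {K : Type*} [CommRing K] (X Y : Matrix (Fin 1) (Fin 1) K) :
    QuadMat.perp X Y = !![X 0 0, 0; 0, Y 0 0] := by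
  ext i j; fin_cases i <;> fin_cases j <;> rfl

theorem perp_U0 {K : Type*} [Field K] (ε p : K) :
    QuadMat.perp (QuadMat.U0 ε) (p • QuadMat.U0 ε) = Matrix.diagonal ![1, ε, p, p * ε] := by
  rw [perp_two_two, QuadMat.U0, perp_one_one]
  ext i j; fin_cases i <;> fin_cases j <;> simp

theorem two_smul_perp_U0 {p : ℕ} [hp : Fact p.Prime] (ε : ℤ_[p]) :
    (2 : ℚ_[p]) • QuadMat.perp (QuadMat.U0 (ε : ℚ_[p])) ((p : ℚ_[p]) • QuadMat.U0 (ε : ℚ_[p])) =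
      ((2 : ℤ_[p]) • Matrix.diagonal ![1, ε, (p : ℤ_[p]), p * ε]).map
        (algebraMap ℤ_[p] ℚ_[p]) := by
  have h2 : ((2 : ℤ_[p]) : ℚ_[p]) = 2 := by norm_cast
  rw [perp_U0]
  ext i j
  fin_cases i <;> fin_cases j <;> simp [h2]

theorem two_smul_H2 (K : Type*) [Field K] (h : (2 : K) ≠ 0) :
    (2 : K) • QuadMat.H2 K = !![0, 1, 0, 0; 1, 0, 0, 0; 0, 0, 0, 1; 0, 0, 1, 0] := by
  rw [QuadMat.H2, perp_two_two, QuadMat.H]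
  ext i j; fin_cases i <;> fin_cases j <;> simp [h]

/-- A square `a` gives `ℚ_p(√a) = ℚ_p`, where `chi` is 1. For the unit `-ε` this is all that is
needed, because nonsquare units form a single square class when `p` is odd. -/
theorem not_isSquare_of_chi {p : ℕ} [hp : Fact p.Prime] {a : ℤ_[p]}
    (h : QuadMat.chi p a = -1) : ¬ IsSquare a := by
  rintro ⟨t, rfl⟩
  have hbot : QuadMat.sqrtField p (t * t) = ⊥ := by
    rw [QuadMat.sqrtField, ← le_bot_iff, IntermediateField.adjoin_le_iff]
    intro x hx
    have hx' : (x - algebraMap ℚ_[p] _ (t : ℚ_[p])) * (x + algebraMap ℚ_[p] _ (t : ℚ_[p])) = 0 := by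
      have hx : x ^ 2 = algebraMap ℚ_[p] (AlgebraicClosure ℚ_[p]) ((t * t : ℤ_[p]) : ℚ_[p]) := hx
      rw [PadicInt.coe_mul, map_mul] at hx
      linear_combination hx
    rw [SetLike.mem_coe, IntermediateField.mem_bot]
    rcases mul_eq_zero.1 hx' with h | h
    · exact ⟨t, by linear_combination -h⟩
    · exact ⟨-t, by rw [map_neg]; linear_combination -h⟩
  rw [QuadMat.chi, if_pos hbot] at h
  norm_num at h

/-- Equivalences are found for the integral Gram matrix of `2S` and halved over `ℚ_q`, where 2 is
invertible. -/
theorem glEquiv_of_gram {q : ℕ} [hq : Fact q.Prime] {S : Matrix (Fin 4) (Fin 4) ℚ}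
    {C : Matrix (Fin 4) (Fin 4) ℤ} (hC : (2 : ℚ) • S = (C + Cᵀ).map (fun z : ℤ => (z : ℚ)))
    {X : Matrix.GeneralLinearGroup (Fin 4) ℤ_[q]} {M : Matrix (Fin 4) (Fin 4) ℤ_[q]}
    (hX : (X : Matrix (Fin 4) (Fin 4) ℤ_[q])ᵀ * (C + Cᵀ).map (Int.castRingHom ℤ_[q]) *
      (X : Matrix (Fin 4) (Fin 4) ℤ_[q]) = M) {N : Matrix (Fin 4) (Fin 4) ℚ_[q]}
    (hN : (2 : ℚ_[q]) • N = M.map (algebraMap ℤ_[q] ℚ_[q])) :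
    QuadMat.GLEquiv ℤ_[q] (S.map (fun x : ℚ => (x : ℚ_[q]))) N := by
  refine ⟨X, ?_⟩
  have h2 : (2 : ℚ_[q]) ≠ 0 := two_ne_zero
  have hS : (2 : ℚ_[q]) • S.map (fun x : ℚ => (x : ℚ_[q])) =
      ((C + Cᵀ).map (Int.castRingHom ℤ_[q])).map (algebraMap ℤ_[q] ℚ_[q]) := by
    ext i j
    have := congrArg (fun x : ℚ => (x : ℚ_[q])) (congrFun (congrFun hC i) j)
    simpa using this
  have : (2 : ℚ_[q]) • N = (2 : ℚ_[q]) • QuadMat.transf (S.map (fun x : ℚ => (x : ℚ_[q])))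
      ((X : Matrix (Fin 4) (Fin 4) ℤ_[q]).map (algebraMap ℤ_[q] ℚ_[q])) := by
    rw [hN, QuadMat.transf, ← hX, Matrix.map_mul, Matrix.map_mul, ← hS, ← Matrix.transpose_map]
    simp
  exact smul_right_injective _ h2 this

theorem exists_integral_data {p : ℕ} [hp : Fact p.Prime] {S : Matrix (Fin 4) (Fin 4) ℚ}
    (hS : S ∈ QuadMat.halfIntegral ℤ ℚ 4) (hlev : QuadMat.HasLevel S p)
    (hdet : S.det = (p : ℚ) ^ 2 / 16) :
    ∃ C T : Matrix (Fin 4) (Fin 4) ℤ, (2 : ℚ) • S = (C + Cᵀ).map (fun z : ℤ => (z : ℚ)) ∧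
      (C + Cᵀ) * T = (p : ℤ) • 1 ∧ (C + Cᵀ).det = (p : ℤ) ^ 2 := by
  obtain ⟨C, hC⟩ := mem_halfIntegral_iff.1 hS
  obtain ⟨D, hD⟩ := mem_halfIntegral_iff.1 hlev.1.2
  rw [smul_smul, show (2 : ℚ) * (1 / 2) = 1 by norm_num, one_smul] at hD
  have hp0 : (p : ℚ) ≠ 0 := by exact_mod_cast hp.out.ne_zero
  have hdet2 : ((2 : ℚ) • S).det = (p : ℚ) ^ 2 := by
    rw [Matrix.det_smul, hdet]; simp; ring
  have hu : IsUnit ((2 : ℚ) • S).det := by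
    rw [hdet2]; exact isUnit_iff_ne_zero.2 (by positivity)
  have hinj : Function.Injective fun M : Matrix (Fin 4) (Fin 4) ℤ => M.map (Int.castRingHom ℚ) :=
    Matrix.map_injective (RingHom.injective_int _)
  refine ⟨C, D + Dᵀ, hC, hinj ?_, ?_⟩
  · simp only [Matrix.map_mul]
    have h : ((2 : ℚ) • S) * ((p : ℚ) • ((2 : ℚ) • S)⁻¹) = (p : ℚ) • 1 := by
      rw [Matrix.mul_smul, Matrix.mul_nonsing_inv _ hu]
    rw [hC] at h
    rw [hC] at hD
    rw [hD] at h
    refine h.trans ?_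
    ext i j
    by_cases hij : i = j
    · subst hij; simp [Matrix.natCast_apply]
    · simp [Matrix.natCast_apply, hij]
  · have h : ((C + Cᵀ).map (fun z : ℤ => (z : ℚ))).det = ((C + Cᵀ).det : ℚ) :=
      (RingHom.map_det (Int.castRingHom ℚ) _).symm
    rw [← hC, hdet2] at h
    exact_mod_cast h.symm

theorem localForm_of_ne {p q : ℕ} [hp : Fact p.Prime] [hq : Fact q.Prime] (hqp : q ≠ p)
    {S : Matrix (Fin 4) (Fin 4) ℚ} {C : Matrix (Fin 4) (Fin 4) ℤ}
    (hC : (2 : ℚ) • S = (C + Cᵀ).map (fun z : ℤ => (z : ℚ))) (hdet : (C + Cᵀ).det = (p : ℤ) ^ 2) :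
    QuadMat.GLEquiv ℤ_[q] (S.map (fun x : ℚ => (x : ℚ_[q]))) (QuadMat.H2 ℚ_[q]) := by
  have hpu : IsUnit (p : ℤ_[q]) := by
    rw [padicInt_isUnit_iff_toZMod, map_natCast, Ne, ZMod.natCast_eq_zero_iff,
      Nat.prime_dvd_prime_iff_eq hq.out hp.out]
    exact hqp
  have hmap : (C + Cᵀ).map (Int.castRingHom ℤ_[q]) =
      C.map (Int.castRingHom ℤ_[q]) + (C.map (Int.castRingHom ℤ_[q]))ᵀ := by
    ext i j; simp
  obtain ⟨X, hX⟩ := exists_hyperbolic (C.map (Int.castRingHom ℤ_[q])) hpu (by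
    rw [← hmap]
    have := RingHom.map_det (Int.castRingHom ℤ_[q]) (C + Cᵀ)
    rw [RingHom.mapMatrix_apply] at this
    rw [← this, hdet]; simp)
  rw [← hmap] at hX
  refine glEquiv_of_gram hC hX ?_
  rw [two_smul_H2 _ two_ne_zero]
  ext i j; fin_cases i <;> fin_cases j <;> simp

theorem diagonal_scale {R : Type*} [CommRing R] {a b p r s ε : R} (h : r * a * r = ε)
    (h' : s * b * s = ε) :
    Matrix.diagonal ![1, r, 1, s] * Matrix.diagonal ![1, a, p, p * b] *
      Matrix.diagonal ![1, r, 1, s] = Matrix.diagonal ![1, ε, p, p * ε] := by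
  rw [diagonal_mul_diagonal, diagonal_mul_diagonal]
  congr 1
  ext i
  fin_cases i
  · simp
  · simpa using h
  · simp
  · simp only [← h']
    simp; ring

theorem localForm_self {p : ℕ} [hp : Fact p.Prime] (h2 : p ≠ 2) {ε : ℤ_[p]ˣ}
    (hε : ¬ IsSquare (-(ε : ℤ_[p]))) {S : Matrix (Fin 4) (Fin 4) ℚ}
    (hpos : (S.map (fun x : ℚ => (x : ℝ))).PosDef) (hSdet : S.det = (p : ℚ) ^ 2 / 16)
    {C T : Matrix (Fin 4) (Fin 4) ℤ}
    (hC : (2 : ℚ) • S = (C + Cᵀ).map (fun z : ℤ => (z : ℚ)))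
    (hT : (C + Cᵀ) * T = (p : ℤ) • 1) (hdet : (C + Cᵀ).det = (p : ℤ) ^ 2) :
    QuadMat.GLEquiv ℤ_[p] (S.map (fun x : ℚ => (x : ℚ_[p])))
      (QuadMat.perp (QuadMat.U0 ((ε : ℤ_[p]) : ℚ_[p]))
        ((p : ℚ_[p]) • QuadMat.U0 ((ε : ℤ_[p]) : ℚ_[p]))) := by
  obtain ⟨u, hu⟩ := padicInt_isUnit_two (p := p) h2
  have hu' : (↑u⁻¹ : ℤ_[p]) * 2 = 1 := by rw [← hu]; simp
  set G : Matrix (Fin 4) (Fin 4) ℤ_[p] := (C + Cᵀ).map (Int.castRingHom ℤ_[p]) with hG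
  have hGs : Gᵀ = G := by ext i j; simp [hG, add_comm]
  have hGdet : G.det = (p : ℤ_[p]) ^ 2 := by
    have := RingHom.map_det (Int.castRingHom ℤ_[p]) (C + Cᵀ)
    rw [RingHom.mapMatrix_apply] at this
    rw [hG, ← this, hdet]; simp
  have hGT : G * T.map (Int.castRingHom ℤ_[p]) = (p : ℤ_[p]) • 1 := by
    rw [hG, ← Matrix.map_mul, hT]
    ext i j
    by_cases hij : i = j
    · subst hij; simp [Matrix.natCast_apply]
    · simp [Matrix.natCast_apply, hij]
  -- Since 2 is a unit, `S` itself is integral at `p`, and `A` is its matrix.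
  set A : Matrix (Fin 4) (Fin 4) ℤ_[p] := (↑u⁻¹ : ℤ_[p]) • G with hA
  have h2A : (2 : ℤ_[p]) • A = G := by rw [hA, smul_smul, mul_comm, hu', one_smul]
  have hAdet : A.det = (p : ℤ_[p]) ^ 2 * (↑u⁻¹ : ℤ_[p]) ^ 4 := by
    rw [hA, Matrix.det_smul, hGdet, Fintype.card_fin, mul_comm]
  obtain ⟨X₁, a, b, c, d, ha, hb, hc, hd, hX₁⟩ := padicInt_exists_diag h2 (A := A)
    (T := (2 : ℤ_[p]) • T.map (Int.castRingHom ℤ_[p])) (by rw [hA, transpose_smul, hGs])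
    (by rw [Matrix.mul_smul, ← Matrix.smul_mul, h2A, hGT])
    (u⁻¹.isUnit.pow 4) hAdet
  obtain ⟨x, y, hxy⟩ := padicInt_exists_binary_one h2 ha hb
  obtain ⟨z, w, hzw⟩ := padicInt_exists_binary_one h2 hc hd
  obtain ⟨X₂, hX₂⟩ := exists_GL_diagonal_one (p := (p : ℤ_[p])) hxy hzw
  have hX : ((X₁ * X₂ : Matrix.GeneralLinearGroup (Fin 4) ℤ_[p]) :
      Matrix (Fin 4) (Fin 4) ℤ_[p])ᵀ * A * ((X₁ * X₂ : Matrix.GeneralLinearGroup (Fin 4) ℤ_[p]) :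
      Matrix (Fin 4) (Fin 4) ℤ_[p]) = Matrix.diagonal ![1, a * b, (p : ℤ_[p]), p * (c * d)] := by
    rw [← hX₂, ← hX₁, Units.val_mul, transpose_mul]
    simp only [Matrix.mul_assoc]
  -- Comparing determinants: `det A` is `p²` times a square, hence so is `p² abcd`.
  obtain ⟨v, hv, hδ⟩ : ∃ v : ℤ_[p], IsUnit v ∧ (a * b) * (c * d) = v ^ 2 := by
    have hXu : IsUnit (X₁ : Matrix (Fin 4) (Fin 4) ℤ_[p]).det :=
      (Matrix.isUnit_iff_isUnit_det _).1 X₁.isUnit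
    refine ⟨(X₁ : Matrix (Fin 4) (Fin 4) ℤ_[p]).det * (↑u⁻¹ : ℤ_[p]) ^ 2,
      hXu.mul (u⁻¹.isUnit.pow 2), ?_⟩
    have h := congrArg Matrix.det hX₁
    rw [det_mul, det_mul, det_transpose, hAdet, det_diagonal, Fin.prod_univ_four] at h
    have hp0 : (p : ℤ_[p]) ^ 2 ≠ 0 := pow_ne_zero _ (PadicInt.prime_p).ne_zero
    refine mul_left_cancel₀ hp0 ?_
    simp at h
    linear_combination -h
  have hδu := ha.mul hb
  have hδu' := hc.mul hd
  -- The only global step at `p`: positive definiteness over `ℝ` enters through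
  -- `false_of_linear_form`.
  have hns : ¬ IsSquare (-(a * b)) := by
    rintro ⟨t, ht⟩
    rw [show a * b = -(t * t) by rw [← ht, neg_neg]] at hX
    obtain ⟨l, j, hj, hl⟩ := exists_linear_form hX
    refine false_of_linear_form (p := p) (C := C) hpos ?_ ?_ hj fun x hx => ?_
    · ext i j
      have := congrArg (fun x : ℚ => (x : ℝ)) (congrFun (congrFun hC i) j)
      simpa using this
    · have := RingHom.map_det (Rat.castHom ℝ) S
      rw [RingHom.mapMatrix_apply, hSdet] at this
      refine this.symm.trans ?_
      simp
    · have h := hl x hx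
      have e : (fun i => (x i : ℤ_[p])) ⬝ᵥ (A *ᵥ fun i => (x i : ℤ_[p])) =
          ((x ⬝ᵥ (C *ᵥ x) : ℤ) : ℤ_[p]) := by
        have hAe : ∀ i j, A i j = (↑u⁻¹ : ℤ_[p]) * (C i j + C j i) := fun i j => by
          simp [hA, hG]
        simp only [dotProduct, Matrix.mulVec, Fin.sum_univ_four, hAe]
        push_cast
        linear_combination (x 0 * (C 0 0 * x 0 + C 0 1 * x 1 + C 0 2 * x 2 + C 0 3 * x 3) +
          x 1 * (C 1 0 * x 0 + C 1 1 * x 1 + C 1 2 * x 2 + C 1 3 * x 3) +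
          x 2 * (C 2 0 * x 0 + C 2 1 * x 1 + C 2 2 * x 2 + C 2 3 * x 3) +
          x 3 * (C 3 0 * x 0 + C 3 1 * x 1 + C 3 2 * x 2 + C 3 3 * x 3) : ℤ_[p]) * hu'
      rw [e, map_intCast] at h
      exact (ZMod.intCast_zmod_eq_zero_iff_dvd _ p).1 h
  obtain ⟨s, hs⟩ := padicInt_isSquare_mul h2 hδu.neg ε.isUnit.neg hns hε
  have hs' : (a * b) * ε = s * s := by linear_combination hs
  have hsu : IsUnit s := by
    have : IsUnit (s * s) := hs' ▸ hδu.mul ε.isUnit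
    exact isUnit_of_mul_isUnit_left this
  obtain ⟨e, he⟩ := hδu
  obtain ⟨f, hf⟩ := hv
  have he' : (↑e⁻¹ : ℤ_[p]) * (a * b) = 1 := by rw [← he]; simp
  have hf' : (↑f⁻¹ : ℤ_[p]) * v = 1 := by rw [← hf]; simp
  -- From `abε = s²` and `abcd = v²`, the scalings `s/(ab)` and `s/v` carry `ab` and `cd`
  -- respectively to `ε`.
  set r := s * (↑e⁻¹ : ℤ_[p]) with hr
  set r' := s * (↑f⁻¹ : ℤ_[p]) with hr'
  have h1 : r * (a * b) * r = ε := by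
    have : r * (a * b) * r * (a * b) = ε * (a * b) := by
      rw [hr]
      linear_combination (s * s * ((↑e⁻¹ : ℤ_[p]) * (a * b) + 1)) * he' - hs'
    exact ha.mul hb |>.mul_right_cancel this
  have h1' : r' * (c * d) * r' = ε := by
    have : r' * (c * d) * r' * (a * b) = ε * (a * b) := by
      rw [hr']
      linear_combination (s * s * (↑f⁻¹ : ℤ_[p]) ^ 2) * hδ +
        (s * s * ((↑f⁻¹ : ℤ_[p]) * v + 1)) * hf' - hs'
    exact ha.mul hb |>.mul_right_cancel this
  have hYu : IsUnit (Matrix.diagonal ![1, r, 1, r']) := by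
    rw [Matrix.isUnit_iff_isUnit_det, det_diagonal, Fin.prod_univ_four]
    have hru : IsUnit r := hsu.mul e⁻¹.isUnit
    have hru' : IsUnit r' := hsu.mul f⁻¹.isUnit
    simp [hru, hru']
  have hXY : ((X₁ * X₂ * hYu.unit : Matrix.GeneralLinearGroup (Fin 4) ℤ_[p]) :
      Matrix (Fin 4) (Fin 4) ℤ_[p])ᵀ * G * ((X₁ * X₂ * hYu.unit :
      Matrix.GeneralLinearGroup (Fin 4) ℤ_[p]) : Matrix (Fin 4) (Fin 4) ℤ_[p]) =
      (2 : ℤ_[p]) • Matrix.diagonal ![1, (ε : ℤ_[p]), (p : ℤ_[p]), p * ε] := by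
    rw [← h2A, Matrix.mul_smul, Matrix.smul_mul, Units.val_mul (X₁ * X₂), transpose_mul,
      IsUnit.unit_spec, diagonal_transpose]
    refine congrArg (fun M => (2 : ℤ_[p]) • M) ?_
    rw [← diagonal_scale h1 h1', ← hX]
    simp only [Matrix.mul_assoc]
  exact glEquiv_of_gram hC hXY (two_smul_perp_U0 _)

theorem lemma3p4 (p : ℕ) [Fact p.Prime] (hp : p ≠ 2) (ε : ℤ_[p]ˣ)
    (hε : QuadMat.chi p (-(ε : ℤ_[p])) = -1) :
    (∃ S : Matrix (Fin 4) (Fin 4) ℚ, S ∈ QuadMat.posHalfIntegral 4 ∧ QuadMat.HasLevel S p ∧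
      S.det = (p : ℚ) ^ 2 / 16 ∧ QuadMat.LocalForms p ε S) ∧
    ∀ S : Matrix (Fin 4) (Fin 4) ℚ, S ∈ QuadMat.posHalfIntegral 4 → QuadMat.HasLevel S p →
      S.det = (p : ℚ) ^ 2 / 16 → QuadMat.LocalForms p ε S := by
  have key : ∀ S : Matrix (Fin 4) (Fin 4) ℚ, S ∈ QuadMat.posHalfIntegral 4 →
      QuadMat.HasLevel S p → S.det = (p : ℚ) ^ 2 / 16 → QuadMat.LocalForms p ε S := by
    intro S hS hlev hdet
    obtain ⟨C, T, hC, hT, hCdet⟩ := exists_integral_data hS.1 hlev hdet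
    exact ⟨localForm_self hp (not_isSquare_of_chi hε) hS.2 hdet hC hT hCdet,
      fun q _ hq => localForm_of_ne hq hC hCdet⟩
  obtain ⟨S, hS, hlev, hdet⟩ := exists_posHalfIntegral hp
  exact ⟨⟨S, hS, hlev, hdet, key S hS hlev hdet⟩, key⟩
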